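/- Let $H$ be a separable complex Hilbert space. A nest $\mathcal N$ on $H$ is a totally ordered set of orthogonal projections on $H$ that contains $0$ and $I$ and is closed under arbitrary joins and meets; $\mathcal T(\mathcal N)$ denotes the nest algebra, i.e. the algebra of all bounded operators on $H$ that leave the range of every $N\in\mathcal N$ invariant. An interval of $\mathcal N$ is a difference $N-M$ with $M<N$ in $\mathcal N$; the minimal intervals are called atoms, and $\mathcal N$ is atomic if the join of its atoms is $I$. For $X\in\mathcal T(\mathcal N)$ put $$i_N^+(X)=\inf\{\|(M-N)X(M-N)\| : M\in\mathcal N,\ M>N\}\quad(N\in\mathcal N,\ N<I),$$ $$i_N^-(X)=\inf\{\|(N-M)X(N-M)\| : M\in\mathcal N,\ M<N\}\quad(N\in\mathcal N,\ N>0).$$ The diagonal ideals of $\mathcal T(\mathcal N)$ are the two-sided ideals $\mathcal I_N^{+}=\{X\in\mathcal T(\mathcal N): i_N^{+}(X)=0\}$ for $N<I$ and $\mathcal I_N^{-}=\{X\in\mathcal T(\mathcal N): i_N^{-}(X)=0\}$ for $N>0$. A left (resp. right) primitive ideal is the annihilator of a simple left (resp. right) module. Proposition. Let $\mathcal N$ be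 an atomic nest on $H$ and let $\mathcal P$ be a left or right primitive ideal of $\mathcal T(\mathcal N)$. Then $\mathcal P$ contains exactly one diagonal ideal $\mathcal I_{\mathcal P}$, and if $\mathcal P\neq\mathcal I_{\mathcal P}$, then there is a nonzero orthogonal projection in $\mathcal P\setminus\mathcal I_{\mathcal P}$. -/

import Mathlib

open scoped InnerProductSpace

universe u

/-! ### Primitive ideals of a unital ring -/

/-- A two-sided ideal is (left) primitive if it is the annihilator of a simple left module. -/
def IsLeftPrimitive {A : Type u} [Ring A] (P : TwoSidedIdeal A) : Prop :=
  ∃ (V : Type u) (_ : AddCommGroup V) (_ : Module A V), IsSimpleModule A V ∧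
    ∀ a : A, a ∈ P ↔ ∀ v : V, a • v = 0

/-- A two-sided ideal is right primitive if it is the annihilator of a simple right module
(a right `A`-module being a left module over the opposite ring). -/
def IsRightPrimitive {A : Type u} [Ring A] (P : TwoSidedIdeal A) : Prop :=
  ∃ (V : Type u) (_ : AddCommGroup V) (_ : Module Aᵐᵒᵖ V), IsSimpleModule Aᵐᵒᵖ V ∧
    ∀ a : A, a ∈ P ↔ ∀ v : V, MulOpposite.op a • v = 0

/-! ### Nests -/

/-- A nest on a complex Hilbert space: a totally ordered set of closed subspaces (identified with
the orthogonal projections onto them) which contains `0` and the whole space and is closed under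
arbitrary joins (closed linear spans) and meets (intersections). -/
structure Nest (H : Type u) [NormedAddCommGroup H] [InnerProductSpace ℂ H] where
  carrier : Set (ClosedSubmodule ℂ H)
  isChain : IsChain (· ≤ ·) carrier
  bot_mem : ⊥ ∈ carrier
  top_mem : ⊤ ∈ carrier
  sSup_mem : ∀ S : Set (ClosedSubmodule ℂ H), S ⊆ carrier → sSup S ∈ carrier
  sInf_mem : ∀ S : Set (ClosedSubmodule ℂ H), S ⊆ carrier → sInf S ∈ carrier

namespace Nest

variable {H : Type u} [NormedAddCommGroup H] [InnerProductSpace ℂ H]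

instance : Membership (ClosedSubmodule ℂ H) (Nest H) where
  mem 𝒩 N := N ∈ 𝒩.carrier

/-- The nest algebra: the bounded operators that leave every member of the nest invariant. -/
def algebra (𝒩 : Nest H) : Subalgebra ℂ (H →L[ℂ] H) where
  carrier := {T | ∀ N ∈ 𝒩, ∀ x ∈ N, T x ∈ N}
  mul_mem' {S T} hS hT N hN x hx := hS N hN _ (hT N hN x hx)
  add_mem' {S T} hS hT N hN x hx := add_mem (hS N hN x hx) (hT N hN x hx)
  algebraMap_mem' c N hN x hx := by
    rw [Algebra.algebraMap_eq_smul_one]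
    exact SMulMemClass.smul_mem c hx

/-- The ranges of the intervals of the nest: the interval `N - M` (for `M < N` in the nest) is the
projection onto `N ⊓ Mᗮ`. -/
def intervals (𝒩 : Nest H) : Set (ClosedSubmodule ℂ H) :=
  {E | ∃ M ∈ 𝒩, ∃ N ∈ 𝒩, M < N ∧ E = N ⊓ Mᗮ}

/-- The (ranges of the) atoms of the nest: its minimal intervals. -/
def atoms (𝒩 : Nest H) : Set (ClosedSubmodule ℂ H) :=
  {E | Minimal (· ∈ 𝒩.intervals) E}

/-- A nest is atomic if the join of its atoms is the identity. -/
def IsAtomic (𝒩 : Nest H) : Prop := sSup 𝒩.atoms = ⊤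

variable [CompleteSpace H]

/-- The interval `N - M`, as a difference of orthogonal projections. -/
noncomputable def intervalProj (M N : ClosedSubmodule ℂ H) : H →L[ℂ] H :=
  N.toSubmodule.starProjection - M.toSubmodule.starProjection

/-- The diagonal seminorm `i⁺_N(X) = inf {‖(M - N) X (M - N)‖ : M > N in the nest}`. -/
noncomputable def upperSeminorm (𝒩 : Nest H) (N : ClosedSubmodule ℂ H) (X : 𝒩.algebra) : ℝ :=
  ⨅ M : {M : ClosedSubmodule ℂ H // M ∈ 𝒩 ∧ N < M},
    ‖intervalProj N M * (X : H →L[ℂ] H) * intervalProj N M‖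

/-- The diagonal seminorm `i⁻_N(X) = inf {‖(N - M) X (N - M)‖ : M < N in the nest}`. -/
noncomputable def lowerSeminorm (𝒩 : Nest H) (N : ClosedSubmodule ℂ H) (X : 𝒩.algebra) : ℝ :=
  ⨅ M : {M : ClosedSubmodule ℂ H // M ∈ 𝒩 ∧ M < N},
    ‖intervalProj M N * (X : H →L[ℂ] H) * intervalProj M N‖

/-! Facts needed to see that the kernels of the diagonal seminorms are two-sided ideals. -/

theorem proj_mul_of_le {M N : ClosedSubmodule ℂ H} (h : M ≤ N) :
    N.toSubmodule.starProjection * M.toSubmodule.starProjection =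
      M.toSubmodule.starProjection := by
  ext x
  exact Submodule.starProjection_eq_self_iff.2
    (h (Submodule.starProjection_apply_mem M.toSubmodule x))

theorem proj_mul_of_ge {M N : ClosedSubmodule ℂ H} (h : M ≤ N) :
    M.toSubmodule.starProjection * N.toSubmodule.starProjection =
      M.toSubmodule.starProjection := by
  have := congrArg star (proj_mul_of_le h)
  rwa [star_mul, (isStarProjection_starProjection (U := M.toSubmodule)).isSelfAdjoint.star_eq,
    (isStarProjection_starProjection (U := N.toSubmodule)).isSelfAdjoint.star_eq] at this

theorem algebra_mul_proj (𝒩 : Nest H) {N : ClosedSubmodule ℂ H} (hN : N ∈ 𝒩) (X : 𝒩.algebra) :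
    N.toSubmodule.starProjection * (X : H →L[ℂ] H) * N.toSubmodule.starProjection =
      (X : H →L[ℂ] H) * N.toSubmodule.starProjection := by
  ext x
  exact Submodule.starProjection_eq_self_iff.2
    (X.2 N hN _ (Submodule.starProjection_apply_mem N.toSubmodule x))

/-- `intervalProj M N` is the orthogonal projection onto `N ⊓ Mᗮ`. -/
theorem intervalProj_eq {M N : ClosedSubmodule ℂ H} (h : M ≤ N) :
    intervalProj M N = (N ⊓ Mᗮ).toSubmodule.starProjection := by
  ext x
  symm
  refine Submodule.eq_starProjection_of_mem_of_inner_eq_zero ?_ ?_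
  · refine ⟨sub_mem (Submodule.starProjection_apply_mem _ x)
      (h (Submodule.starProjection_apply_mem M.toSubmodule x)), ?_⟩
    intro w hw
    have h1 := Submodule.starProjection_inner_eq_zero (K := N.toSubmodule) x w (h hw)
    have h2 := Submodule.starProjection_inner_eq_zero (K := M.toSubmodule) x w hw
    rw [← inner_conj_symm]
    simp only [intervalProj, sub_apply, inner_sub_left, map_sub] at *
    simp only [← map_sub]
    rw [show ∀ a b c : ℂ, b - c = (a - c) - (a - b) by intros; ring]
    rw [h1, h2]; simp
  · intro w hw
    have h1 := Submodule.starProjection_inner_eq_zero (K := N.toSubmodule) x w hw.1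
    have h2 : ⟪M.toSubmodule.starProjection x, w⟫_ℂ = 0 :=
      hw.2 _ (Submodule.starProjection_apply_mem M.toSubmodule x)
    simp only [intervalProj, sub_apply, inner_sub_left] at *
    rw [h2]; simpa using h1

theorem norm_intervalProj_le {M N : ClosedSubmodule ℂ H} (h : M ≤ N) :
    ‖intervalProj M N‖ ≤ 1 := by
  rw [intervalProj_eq h]
  exact Submodule.starProjection_norm_le _

/-- Compression to an interval is multiplicative on the nest algebra. -/
theorem compress_mul (𝒩 : Nest H) {M N : ClosedSubmodule ℂ H} (hM : M ∈ 𝒩) (hN : N ∈ 𝒩)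
    (h : M ≤ N) (X Y : 𝒩.algebra) :
    intervalProj M N * ((X * Y : 𝒩.algebra) : H →L[ℂ] H) * intervalProj M N =
      (intervalProj M N * (X : H →L[ℂ] H) * intervalProj M N) *
        ((Y : H →L[ℂ] H) * intervalProj M N) := by
  set e := intervalProj M N with he
  have h1 : e * (X : H →L[ℂ] H) * M.toSubmodule.starProjection = 0 := by
    rw [mul_assoc, ← algebra_mul_proj 𝒩 hM X, ← mul_assoc, ← mul_assoc, he, intervalProj, sub_mul,
      proj_mul_of_le h, proj_mul_of_le le_rfl, sub_self, zero_mul, zero_mul]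
  have h2 : N.toSubmodule.starProjection * ((Y : H →L[ℂ] H) * e) = (Y : H →L[ℂ] H) * e := by
    have h3 : N.toSubmodule.starProjection * e = e := by
      rw [he, intervalProj, mul_sub, proj_mul_of_le h, proj_mul_of_le le_rfl]
    rw [← h3, ← mul_assoc, ← mul_assoc, algebra_mul_proj 𝒩 hN Y, mul_assoc]
  have h4 : e * (X : H →L[ℂ] H) * e = e * (X : H →L[ℂ] H) * N.toSubmodule.starProjection := by
    conv_lhs => rw [he, intervalProj, mul_sub, ← intervalProj, ← he, h1, sub_zero]
  rw [h4, mul_assoc _ _ (_ * e), h2, MulMemClass.coe_mul]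
  simp only [mul_assoc]

theorem compress_mul_le_right (𝒩 : Nest H) {M N : ClosedSubmodule ℂ H} (hM : M ∈ 𝒩) (hN : N ∈ 𝒩)
    (h : M ≤ N) (X Y : 𝒩.algebra) :
    ‖intervalProj M N * ((X * Y : 𝒩.algebra) : H →L[ℂ] H) * intervalProj M N‖ ≤
      ‖intervalProj M N * (X : H →L[ℂ] H) * intervalProj M N‖ * ‖(Y : H →L[ℂ] H)‖ := by
  rw [compress_mul 𝒩 hM hN h]
  refine (norm_mul_le _ _).trans (mul_le_mul_of_nonneg_left ?_ (norm_nonneg _))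
  exact (norm_mul_le _ _).trans (mul_le_of_le_one_right (norm_nonneg _) (norm_intervalProj_le h))

theorem compress_mul_le_left (𝒩 : Nest H) {M N : ClosedSubmodule ℂ H} (hM : M ∈ 𝒩) (hN : N ∈ 𝒩)
    (h : M ≤ N) (X Y : 𝒩.algebra) :
    ‖intervalProj M N * ((X * Y : 𝒩.algebra) : H →L[ℂ] H) * intervalProj M N‖ ≤
      ‖(X : H →L[ℂ] H)‖ * ‖intervalProj M N * (Y : H →L[ℂ] H) * intervalProj M N‖ := by
  have he : intervalProj M N * intervalProj M N = intervalProj M N := by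
    rw [intervalProj_eq h]
    exact (isStarProjection_starProjection (U := (N ⊓ Mᗮ).toSubmodule)).isIdempotentElem
  rw [compress_mul 𝒩 hM hN h]
  nth_rw 2 [← he]
  rw [show ∀ a b c d : H →L[ℂ] H, a * b * (c * c) * (d * c) = (a * b * c) * (c * d * c) by
    intros; simp only [mul_assoc]]
  refine (norm_mul_le _ _).trans (mul_le_mul_of_nonneg_right ?_ (norm_nonneg _))
  refine (norm_mul_le _ _).trans ?_
  refine (mul_le_of_le_one_right (norm_nonneg _) (norm_intervalProj_le h)).trans ?_
  exact (norm_mul_le _ _).trans (mul_le_of_le_one_left (norm_nonneg _) (norm_intervalProj_le h))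

/-- Compressing to a smaller interval does not increase the norm. -/
theorem compress_mono {M M' N' N : ClosedSubmodule ℂ H} (h1 : M ≤ M') (h2 : M' ≤ N') (h3 : N' ≤ N)
    (T : H →L[ℂ] H) :
    ‖intervalProj M' N' * T * intervalProj M' N'‖ ≤ ‖intervalProj M N * T * intervalProj M N‖ := by
  have ha : intervalProj M' N' * intervalProj M N = intervalProj M' N' := by
    simp only [intervalProj, sub_mul, mul_sub, proj_mul_of_ge h3, proj_mul_of_ge (h2.trans h3),
      proj_mul_of_le h1, proj_mul_of_le (h1.trans h2)]
    abel
  have hb : intervalProj M N * intervalProj M' N' = intervalProj M' N' := by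
    simp only [intervalProj, sub_mul, mul_sub, proj_mul_of_le h3, proj_mul_of_le (h2.trans h3),
      proj_mul_of_ge h1, proj_mul_of_ge (h1.trans h2)]
    abel
  have hc : intervalProj M' N' * T * intervalProj M' N' =
      intervalProj M' N' * (intervalProj M N * T * intervalProj M N) * intervalProj M' N' := by
    rw [show ∀ a b c : H →L[ℂ] H, a * (b * c * b) * a = (a * b) * c * (b * a) by
      intros; simp only [mul_assoc], ha, hb]
  rw [hc]
  refine (norm_mul_le _ _).trans ?_
  refine (mul_le_of_le_one_right (norm_nonneg _) (norm_intervalProj_le h2)).trans ?_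
  exact (norm_mul_le _ _).trans (mul_le_of_le_one_left (norm_nonneg _) (norm_intervalProj_le h2))

theorem iInf_eq_zero_iff {ι : Type*} [Nonempty ι] {f : ι → ℝ} (hf : ∀ i, 0 ≤ f i) :
    ⨅ i, f i = 0 ↔ ∀ ε > 0, ∃ i, f i < ε := by
  constructor
  · intro h ε hε
    exact exists_lt_of_ciInf_lt (h ▸ hε)
  · intro h
    refine le_antisymm (le_of_forall_pos_lt_add fun ε hε => ?_) (Real.iInf_nonneg hf)
    obtain ⟨i, hi⟩ := h ε hε
    simpa using (ciInf_le ⟨0, by rintro _ ⟨j, rfl⟩; exact hf j⟩ i).trans_lt hi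

theorem upperSeminorm_eq_zero_iff (𝒩 : Nest H) {N : ClosedSubmodule ℂ H} (h : N < ⊤)
    (X : 𝒩.algebra) : 𝒩.upperSeminorm N X = 0 ↔ ∀ ε > 0, ∃ M ∈ 𝒩, N < M ∧
      ‖intervalProj N M * (X : H →L[ℂ] H) * intervalProj N M‖ < ε := by
  have : Nonempty {M : ClosedSubmodule ℂ H // M ∈ 𝒩 ∧ N < M} := ⟨⟨⊤, 𝒩.top_mem, h⟩⟩
  rw [upperSeminorm, iInf_eq_zero_iff fun _ => norm_nonneg _]
  simp only [Subtype.exists, exists_prop, and_assoc]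

theorem lowerSeminorm_eq_zero_iff (𝒩 : Nest H) {N : ClosedSubmodule ℂ H} (h : ⊥ < N)
    (X : 𝒩.algebra) : 𝒩.lowerSeminorm N X = 0 ↔ ∀ ε > 0, ∃ M ∈ 𝒩, M < N ∧
      ‖intervalProj M N * (X : H →L[ℂ] H) * intervalProj M N‖ < ε := by
  have : Nonempty {M : ClosedSubmodule ℂ H // M ∈ 𝒩 ∧ M < N} := ⟨⟨⊥, 𝒩.bot_mem, h⟩⟩
  rw [lowerSeminorm, iInf_eq_zero_iff fun _ => norm_nonneg _]
  simp only [Subtype.exists, exists_prop, and_assoc]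

set_option linter.unusedSectionVars false in
theorem compress_add_le (e S T : H →L[ℂ] H) :
    ‖e * (S + T) * e‖ ≤ ‖e * S * e‖ + ‖e * T * e‖ := by
  rw [mul_add, add_mul]; exact norm_add_le _ _

theorem exists_mul_lt_of_forall_pos {p : ℝ → Prop} (hp : ∀ δ > 0, p δ) (c : ℝ) (hc : 0 ≤ c) {ε : ℝ}
    (hε : 0 < ε) : ∃ δ > 0, p δ ∧ c * δ < ε := by
  refine ⟨ε / (c + 1), by positivity, hp _ (by positivity), ?_⟩
  rw [← mul_div_assoc, div_lt_iff₀ (by positivity)]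
  nlinarith

/-- The diagonal ideal `I⁺_N`, the kernel of the seminorm `i⁺_N`, for `N < I` in the nest. -/
noncomputable def upperIdeal (𝒩 : Nest H) (N : ClosedSubmodule ℂ H) (hN : N ∈ 𝒩) (h : N < ⊤) :
    TwoSidedIdeal 𝒩.algebra :=
  TwoSidedIdeal.mk' {X | 𝒩.upperSeminorm N X = 0}
    ((upperSeminorm_eq_zero_iff 𝒩 h 0).2 fun ε hε => ⟨⊤, 𝒩.top_mem, h, by simpa using hε⟩)
    (fun {X Y} hX hY => by
      rw [Set.mem_ofPred_eq, upperSeminorm_eq_zero_iff 𝒩 h] at *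
      intro ε hε
      obtain ⟨M₁, hM₁, h₁, hX⟩ := hX (ε / 2) (half_pos hε)
      obtain ⟨M₂, hM₂, h₂, hY⟩ := hY (ε / 2) (half_pos hε)
      rcases 𝒩.isChain.total hM₁ hM₂ with hle | hle
      · refine ⟨M₁, hM₁, h₁, (compress_add_le _ _ _).trans_lt ?_⟩
        linarith [compress_mono le_rfl h₁.le hle (Y : H →L[ℂ] H)]
      · refine ⟨M₂, hM₂, h₂, (compress_add_le _ _ _).trans_lt ?_⟩
        linarith [compress_mono le_rfl h₂.le hle (X : H →L[ℂ] H)])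
    (fun {X} hX => by simpa [upperSeminorm] using hX)
    (fun {X Y} hY => by
      rw [Set.mem_ofPred_eq, upperSeminorm_eq_zero_iff 𝒩 h] at *
      intro ε hε
      obtain ⟨δ, -, ⟨M, hM, hNM, hlt⟩, hδ⟩ := exists_mul_lt_of_forall_pos hY _
        (norm_nonneg (X : H →L[ℂ] H)) hε
      refine ⟨M, hM, hNM, (compress_mul_le_left 𝒩 hN hM hNM.le X Y).trans_lt (lt_of_le_of_lt ?_ hδ)⟩
      gcongr)
    (fun {X Y} hX => by
      rw [Set.mem_ofPred_eq, upperSeminorm_eq_zero_iff 𝒩 h] at *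
      intro ε hε
      obtain ⟨δ, -, ⟨M, hM, hNM, hlt⟩, hδ⟩ := exists_mul_lt_of_forall_pos hX _
        (norm_nonneg (Y : H →L[ℂ] H)) hε
      refine ⟨M, hM, hNM, (compress_mul_le_right 𝒩 hN hM hNM.le X Y).trans_lt
        (lt_of_le_of_lt ?_ hδ)⟩
      rw [mul_comm]
      gcongr)

/-- The diagonal ideal `I⁻_N`, the kernel of the seminorm `i⁻_N`, for `N > 0` in the nest. -/
noncomputable def lowerIdeal (𝒩 : Nest H) (N : ClosedSubmodule ℂ H) (hN : N ∈ 𝒩) (h : ⊥ < N) :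
    TwoSidedIdeal 𝒩.algebra :=
  TwoSidedIdeal.mk' {X | 𝒩.lowerSeminorm N X = 0}
    ((lowerSeminorm_eq_zero_iff 𝒩 h 0).2 fun ε hε => ⟨⊥, 𝒩.bot_mem, h, by simpa using hε⟩)
    (fun {X Y} hX hY => by
      rw [Set.mem_ofPred_eq, lowerSeminorm_eq_zero_iff 𝒩 h] at *
      intro ε hε
      obtain ⟨M₁, hM₁, h₁, hX⟩ := hX (ε / 2) (half_pos hε)
      obtain ⟨M₂, hM₂, h₂, hY⟩ := hY (ε / 2) (half_pos hε)
      rcases 𝒩.isChain.total hM₁ hM₂ with hle | hle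
      · refine ⟨M₂, hM₂, h₂, (compress_add_le _ _ _).trans_lt ?_⟩
        linarith [compress_mono hle h₂.le le_rfl (X : H →L[ℂ] H)]
      · refine ⟨M₁, hM₁, h₁, (compress_add_le _ _ _).trans_lt ?_⟩
        linarith [compress_mono hle h₁.le le_rfl (Y : H →L[ℂ] H)])
    (fun {X} hX => by simpa [lowerSeminorm] using hX)
    (fun {X Y} hY => by
      rw [Set.mem_ofPred_eq, lowerSeminorm_eq_zero_iff 𝒩 h] at *
      intro ε hε
      obtain ⟨δ, -, ⟨M, hM, hMN, hlt⟩, hδ⟩ := exists_mul_lt_of_forall_pos hY _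
        (norm_nonneg (X : H →L[ℂ] H)) hε
      refine ⟨M, hM, hMN, (compress_mul_le_left 𝒩 hM hN hMN.le X Y).trans_lt (lt_of_le_of_lt ?_ hδ)⟩
      gcongr)
    (fun {X Y} hX => by
      rw [Set.mem_ofPred_eq, lowerSeminorm_eq_zero_iff 𝒩 h] at *
      intro ε hε
      obtain ⟨δ, -, ⟨M, hM, hMN, hlt⟩, hδ⟩ := exists_mul_lt_of_forall_pos hX _
        (norm_nonneg (Y : H →L[ℂ] H)) hε
      refine ⟨M, hM, hMN, (compress_mul_le_right 𝒩 hM hN hMN.le X Y).trans_lt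
        (lt_of_le_of_lt ?_ hδ)⟩
      rw [mul_comm]
      gcongr)

/-- The diagonal ideals of the nest algebra: the ideals `I⁺_N` for `N < I` and `I⁻_N` for `N > 0`,
where `N` runs over the nest. -/
def IsDiagonalIdeal (𝒩 : Nest H) (I : TwoSidedIdeal 𝒩.algebra) : Prop :=
  (∃ (N : ClosedSubmodule ℂ H) (hN : N ∈ 𝒩) (h : N < ⊤), I = 𝒩.upperIdeal N hN h) ∨
  (∃ (N : ClosedSubmodule ℂ H) (hN : N ∈ 𝒩) (h : ⊥ < N), I = 𝒩.lowerIdeal N hN h)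

end Nest

/-! A primitive ideal `P` of a unital Banach algebra is proper, prime and closed (`IsClosedPrime`),
and only this is used of it.

Since `(1 - N) X N = 0` for `N` in the nest, primeness puts `N` or `1 - N` in `P`, so `P` cuts the
nest in two. Let `a` be the join of the `N` lying in `P`. Modulo `P`, every `X` equals its
compressions to the intervals that start (or end) at `a`; if these can be made small, closedness
gives `X ∈ P`. Hence `P` contains the upper or the lower diagonal ideal at `a`
(`exists_isDiagonalIdeal_le`). Two diagonal ideals in `P` are equal: otherwise they would place
incompatible projections in `P`, except at the two ends of an atom, where the upper and lower ideals
coincide.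

Now let `X ∈ P` lie outside the diagonal ideal `I`. If `I` belongs to an atom, the nest algebra
contains all rank-one operators on that atom, and a rank-one projection is recovered from `X`.
Otherwise `I` sits at a limit point `N`, and the compressions of `X` near `N` are bounded below. The
main step, `IsAtomicLimit.exists_factorization`, produces two projections `p`, `q`, both outside
`I`, such that every `p Y q` has the form `Z X W` in the algebra. Then `p Y q ∈ P` for all `Y`, and
primeness gives `p ∈ P` or `q ∈ P`. Atomicity supplies unit vectors, in every interval, whose
rank-one projections commute with the nest.

The factorization is proved for limits from above in a chain of subspaces that need not be a nest.
Limits from below follow by adjoints and orthogonal complements. -/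

/-! ### The operators leaving a family of closed subspaces invariant -/

section InvariantSubalgebra

variable {H : Type u} [NormedAddCommGroup H] [InnerProductSpace ℂ H]

/-- The bounded operators that leave every member of a family of closed subspaces invariant. -/
def invariantSubalgebra (C : Set (ClosedSubmodule ℂ H)) : Subalgebra ℂ (H →L[ℂ] H) where
  carrier := {T | ∀ N ∈ C, ∀ x ∈ N, T x ∈ N}
  mul_mem' {S T} hS hT N hN x hx := hS N hN _ (hT N hN x hx)
  add_mem' {S T} hS hT N hN x hx := add_mem (hS N hN x hx) (hT N hN x hx)
  algebraMap_mem' c N hN x hx := by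
    rw [Algebra.algebraMap_eq_smul_one]
    exact SMulMemClass.smul_mem c hx

/-- Completeness of these algebras makes Neumann series converge inside them. This is needed for the
closedness of `P` and for inverting `1 + R` in the factorization. -/
theorem isClosed_invariantSubalgebra (C : Set (ClosedSubmodule ℂ H)) :
    IsClosed (invariantSubalgebra C : Set (H →L[ℂ] H)) := by
  have : (invariantSubalgebra C : Set (H →L[ℂ] H)) =
      ⋂ N ∈ C, ⋂ x ∈ N, (fun T : H →L[ℂ] H => T x) ⁻¹' (N : Set H) := by
    ext T
    simp only [Set.mem_iInter, Set.mem_preimage]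
    rfl
  rw [this]
  refine isClosed_biInter fun N _ => isClosed_biInter fun x _ => N.isClosed.preimage ?_
  fun_prop

theorem mem_of_hasSum_mem {N : ClosedSubmodule ℂ H} {f : ℕ → H} {x : H} (h : HasSum f x)
    (hf : ∀ j, f j ∈ N) : x ∈ N :=
  N.isClosed.mem_of_tendsto h (Filter.Eventually.of_forall fun _ => sum_mem fun j _ => hf j)

variable [CompleteSpace H]

instance (C : Set (ClosedSubmodule ℂ H)) : CompleteSpace (invariantSubalgebra C) :=
  (isClosed_invariantSubalgebra C).completeSpace_coe

instance (𝒩 : Nest H) : CompleteSpace 𝒩.algebra :=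
  (isClosed_invariantSubalgebra 𝒩.carrier).completeSpace_coe

end InvariantSubalgebra

/-! ### Primitive ideals of a Banach algebra are prime and closed -/

section Primitive

variable {A : Type u}

/-- If `b v ≠ 0`, simplicity makes `A b v` the whole module, so `a A b ⊆ P` forces `a` to annihilate
it. -/
theorem IsLeftPrimitive.mem_or_mem [Ring A] {P : TwoSidedIdeal A} (hP : IsLeftPrimitive P) {a b : A}
    (h : ∀ y, a * y * b ∈ P) : a ∈ P ∨ b ∈ P := by
  obtain ⟨V, _, _, hV, hann⟩ := hP
  by_contra! hab
  obtain ⟨v, hv⟩ := not_forall.1 (mt (hann b).2 hab.2)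
  refine hab.1 ((hann a).2 fun w => ?_)
  obtain ⟨y, rfl⟩ := IsSimpleModule.toSpanSingleton_surjective A hv w
  simpa [mul_smul] using (hann _).1 (h y) v

theorem IsRightPrimitive.mem_or_mem [Ring A] {P : TwoSidedIdeal A} (hP : IsRightPrimitive P)
    {a b : A} (h : ∀ y, a * y * b ∈ P) : a ∈ P ∨ b ∈ P := by
  obtain ⟨V, _, _, hV, hann⟩ := hP
  by_contra! hab
  obtain ⟨v, hv⟩ := not_forall.1 (mt (hann a).2 hab.1)
  refine hab.2 ((hann b).2 fun w => ?_)
  obtain ⟨y, rfl⟩ := IsSimpleModule.toSpanSingleton_surjective Aᵐᵒᵖ hv w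
  simpa [mul_smul] using (hann _).1 (h y.unop) v

theorem IsLeftPrimitive.one_notMem [Ring A] {P : TwoSidedIdeal A} (hP : IsLeftPrimitive P) :
    (1 : A) ∉ P := by
  obtain ⟨V, _, _, hV, hann⟩ := hP
  intro h
  have := IsSimpleModule.nontrivial A V
  obtain ⟨v, hv⟩ := exists_ne (0 : V)
  exact hv (by simpa using (hann 1).1 h v)

theorem IsRightPrimitive.one_notMem [Ring A] {P : TwoSidedIdeal A} (hP : IsRightPrimitive P) :
    (1 : A) ∉ P := by
  obtain ⟨V, _, _, hV, hann⟩ := hP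
  intro h
  have := IsSimpleModule.nontrivial Aᵐᵒᵖ V
  obtain ⟨v, hv⟩ := exists_ne (0 : V)
  exact hv (by simpa using (hann 1).1 h v)

/-- If `a v ≠ 0`, choose `b` with `b a v = v`. A small `y` congruent to `a` then gives `(1 - b y) v
= 0` with `1 - b y` invertible, so `v = 0`. -/
theorem IsLeftPrimitive.mem_of_forall_norm_lt [NormedRing A] [CompleteSpace A]
    {P : TwoSidedIdeal A} (hP : IsLeftPrimitive P) {a : A}
    (h : ∀ ε > 0, ∃ y, a - y ∈ P ∧ ‖y‖ < ε) : a ∈ P := by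
  obtain ⟨V, _, _, hV, hann⟩ := hP
  refine (hann a).2 fun v => ?_
  by_contra hv
  obtain ⟨b, hb⟩ := IsSimpleModule.toSpanSingleton_surjective A hv v
  obtain ⟨y, hy, hlt⟩ := h (1 / (‖b‖ + 1)) (by positivity)
  have hu : IsUnit (1 - b * y) := isUnit_one_sub_of_norm_lt_one <| by
    refine (norm_mul_le b y).trans_lt ?_
    rw [lt_div_iff₀ (by positivity)] at hlt
    nlinarith [norm_nonneg y, norm_nonneg b]
  have h0 : (1 - b * y) • v = 0 := by
    have := (hann _).1 hy v
    rw [sub_smul, sub_eq_zero] at this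
    rw [LinearMap.toSpanSingleton_apply] at hb
    rw [sub_smul, mul_smul, ← this, hb, one_smul, sub_self]
  exact hv (by rw [(hu.smul_eq_zero).1 h0, smul_zero])

theorem IsRightPrimitive.mem_of_forall_norm_lt [NormedRing A] [CompleteSpace A]
    {P : TwoSidedIdeal A} (hP : IsRightPrimitive P) {a : A}
    (h : ∀ ε > 0, ∃ y, a - y ∈ P ∧ ‖y‖ < ε) : a ∈ P := by
  obtain ⟨V, _, _, hV, hann⟩ := hP
  refine (hann a).2 fun v => ?_
  by_contra hv
  obtain ⟨b, hb⟩ := IsSimpleModule.toSpanSingleton_surjective Aᵐᵒᵖ hv v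
  obtain ⟨y, hy, hlt⟩ := h (1 / (‖b.unop‖ + 1)) (by positivity)
  have hu : IsUnit (1 - y * b.unop) := isUnit_one_sub_of_norm_lt_one <| by
    refine (norm_mul_le y b.unop).trans_lt ?_
    rw [lt_div_iff₀ (by positivity)] at hlt
    nlinarith [norm_nonneg y, norm_nonneg b.unop]
  have h0 : MulOpposite.op (1 - y * b.unop) • v = 0 := by
    have := (hann _).1 hy v
    rw [MulOpposite.op_sub, sub_smul, sub_eq_zero] at this
    rw [LinearMap.toSpanSingleton_apply] at hb
    rw [MulOpposite.op_sub, MulOpposite.op_mul, MulOpposite.op_unop, sub_smul, mul_smul, ← this, hb,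
      MulOpposite.op_one, one_smul, sub_self]
  exact hv (by rw [(hu.op.smul_eq_zero).1 h0, smul_zero])

end Primitive

/-! ### Operators defined by orthogonal families -/

section OrthogonalFamilies

variable {H : Type u} [NormedAddCommGroup H] [InnerProductSpace ℂ H]

theorem orthogonalFamily_span_singleton {f : ℕ → H} (hf : Pairwise fun i j => ⟪f i, f j⟫_ℂ = 0) :
    OrthogonalFamily ℂ (fun j => ℂ ∙ f j) (fun j => (ℂ ∙ f j).subtypeₗᵢ) := by
  intro i j hij x y
  obtain ⟨a, ha⟩ := Submodule.mem_span_singleton.1 x.2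
  obtain ⟨b, hb⟩ := Submodule.mem_span_singleton.1 y.2
  simp [← ha, ← hb, inner_smul_left, inner_smul_right, hf hij]

theorem norm_sum_smul_sq {f : ℕ → H} (hf : Pairwise fun i j => ⟪f i, f j⟫_ℂ = 0) (a : ℕ → ℂ)
    (s : Finset ℕ) : ‖∑ j ∈ s, a j • f j‖ ^ 2 = ∑ j ∈ s, ‖a j • f j‖ ^ 2 :=
  (orthogonalFamily_span_singleton hf).norm_sum
    (fun j => ⟨a j • f j, Submodule.smul_mem _ _ (Submodule.mem_span_singleton_self _)⟩) s

theorem norm_sum_smul_sq_le {f : ℕ → H} (hf : Pairwise fun i j => ⟪f i, f j⟫_ℂ = 0) {C : ℝ}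
    (hC : ∀ j, ‖f j‖ ≤ C) (a : ℕ → ℂ) (s : Finset ℕ) :
    ‖∑ j ∈ s, a j • f j‖ ^ 2 ≤ C ^ 2 * ∑ j ∈ s, ‖a j‖ ^ 2 := by
  rw [norm_sum_smul_sq hf, Finset.mul_sum]
  refine Finset.sum_le_sum fun j _ => ?_
  rw [norm_smul, mul_pow, mul_comm]
  gcongr
  exact hC j

/-- Bessel's inequality for a bounded orthogonal family. -/
theorem sum_norm_inner_sq_le {f : ℕ → H} (hf : Pairwise fun i j => ⟪f i, f j⟫_ℂ = 0) {C : ℝ}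
    (hC : ∀ j, ‖f j‖ ≤ C) (x : H) (s : Finset ℕ) :
    ∑ j ∈ s, ‖⟪f j, x⟫_ℂ‖ ^ 2 ≤ C ^ 2 * ‖x‖ ^ 2 := by
  set S := ∑ j ∈ s, ‖⟪f j, x⟫_ℂ‖ ^ 2 with hS
  have hS0 : 0 ≤ S := Finset.sum_nonneg fun j _ => by positivity
  have h1 := norm_sum_smul_sq_le hf hC (fun j => ⟪f j, x⟫_ℂ) s
  set y := ∑ j ∈ s, ⟪f j, x⟫_ℂ • f j with hy
  -- Pairing `y` with `x` returns `S`, while `‖y‖ ^ 2 ≤ C ^ 2 * S`; after Cauchy–Schwarz one factor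
  -- `S` cancels.
  have h2 : ⟪y, x⟫_ℂ = (S : ℂ) := by
    rw [hy, sum_inner, hS, Complex.ofReal_sum]
    refine Finset.sum_congr rfl fun j _ => ?_
    rw [inner_smul_left, Complex.conj_mul', Complex.ofReal_pow]
  have h3 : S ≤ ‖y‖ * ‖x‖ := by
    have := norm_inner_le_norm (𝕜 := ℂ) y x
    rwa [h2, Complex.norm_real, Real.norm_of_nonneg hS0] at this
  rcases hS0.eq_or_lt with h0 | h0
  · rw [← h0]; positivity
  · have h4 : S * S ≤ S * (C ^ 2 * ‖x‖ ^ 2) := by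
      calc S * S ≤ (‖y‖ * ‖x‖) * (‖y‖ * ‖x‖) := by gcongr
        _ = ‖y‖ ^ 2 * ‖x‖ ^ 2 := by ring
        _ ≤ (C ^ 2 * S) * ‖x‖ ^ 2 := by gcongr
        _ = S * (C ^ 2 * ‖x‖ ^ 2) := by ring
    exact le_of_mul_le_mul_left h4 h0

variable [CompleteSpace H]

/-- Bounded orthogonal families `e` and `f` define a bounded operator `∑ⱼ ⟪eⱼ, ·⟫ fⱼ`. -/
theorem exists_hasSum_inner_smul {e f : ℕ → H} (he : Pairwise fun i j => ⟪e i, e j⟫_ℂ = 0)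
    (hf : Pairwise fun i j => ⟪f i, f j⟫_ℂ = 0) {B C : ℝ} (hB0 : 0 ≤ B) (hC0 : 0 ≤ C)
    (hB : ∀ j, ‖e j‖ ≤ B) (hC : ∀ j, ‖f j‖ ≤ C) :
    ∃ S : H →L[ℂ] H, (∀ x, HasSum (fun j => ⟪e j, x⟫_ℂ • f j) (S x)) ∧ ‖S‖ ≤ B * C := by
  have hsum : ∀ x, Summable fun j => ⟪e j, x⟫_ℂ • f j := by
    intro x
    refine ((orthogonalFamily_span_singleton hf).summable_iff_norm_sq_summable
      (fun j => ⟨⟪e j, x⟫_ℂ • f j,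
        Submodule.smul_mem _ _ (Submodule.mem_span_singleton_self _)⟩)).2 ?_
    refine Summable.of_nonneg_of_le (fun j => by positivity) (fun j => ?_)
      ((summable_of_sum_le (f := fun j => ‖⟪e j, x⟫_ℂ‖ ^ 2) (fun j => by positivity)
        (sum_norm_inner_sq_le he hB x)).mul_right (C ^ 2))
    rw [Submodule.coe_norm, norm_smul, mul_pow]
    gcongr
    exact hC j
  let S : H →ₗ[ℂ] H :=
    { toFun := fun x => ∑' j, ⟪e j, x⟫_ℂ • f j
      map_add' := fun x y => by
        rw [← (hsum x).tsum_add (hsum y)]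
        simp only [inner_add_right, add_smul]
      map_smul' := fun c x => by
        rw [RingHom.id_apply, ← (hsum x).tsum_const_smul c]
        simp only [inner_smul_right, mul_smul] }
  have hS : ∀ x, ‖S x‖ ≤ B * C * ‖x‖ := by
    intro x
    refine le_of_tendsto (hsum x).hasSum.norm (Filter.Eventually.of_forall fun s => ?_)
    refine (pow_le_pow_iff_left₀ (norm_nonneg _) (by positivity) two_ne_zero).1 ?_
    refine (norm_sum_smul_sq_le hf hC _ s).trans ?_
    calc _ ≤ C ^ 2 * (B ^ 2 * ‖x‖ ^ 2) := by gcongr; exact sum_norm_inner_sq_le he hB x s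
      _ = _ := by ring
  exact ⟨S.mkContinuous _ hS, fun x => (hsum x).hasSum, S.mkContinuous_norm_le (by positivity) hS⟩

end OrthogonalFamilies

/-! ### Interval projections -/

namespace Nest

section IntervalProj

variable {H : Type u} [NormedAddCommGroup H] [InnerProductSpace ℂ H] [CompleteSpace H]

theorem intervalProj_mem {M N : ClosedSubmodule ℂ H} (h : M ≤ N) (x : H) :
    intervalProj M N x ∈ N ⊓ Mᗮ := by
  rw [intervalProj_eq h]
  exact Submodule.starProjection_apply_mem _ x

theorem intervalProj_apply_of_mem {M N : ClosedSubmodule ℂ H} (h : M ≤ N) {x : H}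
    (hx : x ∈ N ⊓ Mᗮ) : intervalProj M N x = x := by
  rw [intervalProj_eq h]
  exact Submodule.starProjection_eq_self_iff.2 hx

theorem inner_intervalProj {M N : ClosedSubmodule ℂ H} (h : M ≤ N) {w : H}
    (hw : w ∈ N ⊓ Mᗮ) (x : H) : ⟪w, intervalProj M N x⟫_ℂ = ⟪w, x⟫_ℂ := by
  rw [intervalProj_eq h, ← Submodule.inner_starProjection_left_eq_right,
    Submodule.starProjection_eq_self_iff.2 hw]

theorem norm_intervalProj_apply_le {M N : ClosedSubmodule ℂ H} (h : M ≤ N) (x : H) :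
    ‖intervalProj M N x‖ ≤ ‖x‖ :=
  ((intervalProj M N).le_opNorm x).trans
    (mul_le_of_le_one_left (norm_nonneg _) (norm_intervalProj_le h))

theorem intervalProj_intervalProj {K M N : ClosedSubmodule ℂ H} (h₁ : K ≤ M) (h₂ : M ≤ N) (x : H) :
    intervalProj K M (intervalProj K N x) = intervalProj K M x := by
  have : intervalProj K M * intervalProj K N = intervalProj K M := by
    simp only [intervalProj, sub_mul, mul_sub, proj_mul_of_ge h₂, proj_mul_of_ge (h₁.trans h₂),
      proj_mul_of_le h₁, proj_mul_of_le (le_refl K)]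
    abel
  exact congrArg (fun T : H →L[ℂ] H => T x) this

theorem norm_intervalProj_apply_mono {K M N : ClosedSubmodule ℂ H} (h₁ : K ≤ M) (h₂ : M ≤ N)
    (x : H) : ‖intervalProj K M x‖ ≤ ‖intervalProj K N x‖ := by
  rw [← intervalProj_intervalProj h₁ h₂]
  exact norm_intervalProj_apply_le h₁ _

theorem intervalProj_add_intervalProj (K M N : ClosedSubmodule ℂ H) (x : H) :
    intervalProj M N x + intervalProj K M x = intervalProj K N x := by
  simp [intervalProj]

end IntervalProj

end Nest

open Nest

/-! ### Factorization through an operator that is large near a limit point of a chain -/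

section Chain

variable {H : Type u} [NormedAddCommGroup H] [InnerProductSpace ℂ H] [CompleteSpace H]

/-- `N` is a limit from above of the members of the chain `C`, and every interval above `N`
contains a unit vector that each member of `C` either contains or is orthogonal to. -/
structure IsAtomicLimit (C : Set (ClosedSubmodule ℂ H)) (N : ClosedSubmodule ℂ H) : Prop where
  le_or_le : ∀ K ∈ C, ∀ L ∈ C, K ≤ L ∨ L ≤ K
  exists_gt : ∃ M ∈ C, N < M
  exists_norm_lt : ∀ (x : H), ∀ ε > 0, ∃ M ∈ C, N < M ∧ ‖intervalProj N M x‖ < ε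
  exists_unit : ∀ M ∈ C, N < M → ∃ e ∈ M ⊓ Nᗮ, ‖e‖ = 1 ∧ ∀ K ∈ C, e ∈ K ∨ e ∈ Kᗮ

theorem IsAtomicLimit.exists_le {C : Set (ClosedSubmodule ℂ H)} {N M : ClosedSubmodule ℂ H}
    (hN : IsAtomicLimit C N) (hM : M ∈ C) (hNM : N < M) (x : H) {ε : ℝ} (hε : 0 < ε) :
    ∃ L ∈ C, N < L ∧ L ≤ M ∧ ‖intervalProj N L x‖ < ε := by
  obtain ⟨L, hL, hNL, hlt⟩ := hN.exists_norm_lt x ε hε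
  rcases hN.le_or_le L hL M hM with h | h
  · exact ⟨L, hL, hNL, h, hlt⟩
  · exact ⟨M, hM, hNM, le_rfl, (norm_intervalProj_apply_mono hNM.le h x).trans_lt hlt⟩

/-- Vectors `e`, `u`, `w` in consecutive intervals of a chain with `⟪w, X u⟫ = 1`, such that `X u`
is almost orthogonal to the last interval. -/
structure Link (C : Set (ClosedSubmodule ℂ H)) (N : ClosedSubmodule ℂ H) (X : H →L[ℂ] H)
    (b ε : ℝ) (M : ClosedSubmodule ℂ H) where
  mid : ClosedSubmodule ℂ H
  next : ClosedSubmodule ℂ H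
  e : H
  u : H
  w : H
  mid_mem : mid ∈ C
  next_mem : next ∈ C
  lt_next : N < next
  next_le : next ≤ mid
  mid_le : mid ≤ M
  e_mem : e ∈ M ⊓ midᗮ
  norm_e : ‖e‖ = 1
  e_mem_or : ∀ K ∈ C, e ∈ K ∨ e ∈ Kᗮ
  u_mem : u ∈ mid ⊓ nextᗮ
  norm_u : ‖u‖ ≤ 1
  w_mem : w ∈ mid ⊓ nextᗮ
  norm_w : ‖w‖ ≤ b
  inner_eq : ⟪w, X u⟫_ℂ = 1
  norm_le : ‖intervalProj N next (X u)‖ ≤ ε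

/-- A vector on which the compression of `X` exceeds `c / 2` keeps its effect after tails close to
`N` are cut off from it and from its image, because these tails are arbitrarily small at a limit
point. -/
theorem IsAtomicLimit.nonempty_link {C : Set (ClosedSubmodule ℂ H)} {N M : ClosedSubmodule ℂ H}
    (hN : IsAtomicLimit C N) {X : H →L[ℂ] H} {c : ℝ} (hc : 0 < c)
    (hX : ∀ M ∈ C, N < M → c ≤ ‖intervalProj N M * X * intervalProj N M‖) (hM : M ∈ C)
    (hNM : N < M) {ε : ℝ} (hε : 0 < ε) : Nonempty (Link C N X (4 / c) ε M) := by
  obtain ⟨e, he, hne, hat⟩ := hN.exists_unit M hM hNM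
  -- `B` is so close to `N` that it cannot contain `e`; by the dichotomy for `e`, it is orthogonal
  -- to `e`.
  obtain ⟨B, hB, hNB, hBM, heB⟩ := hN.exists_le hM hNM e one_pos
  have heB' : e ∈ Bᗮ := by
    refine (hat B hB).resolve_left fun h => ?_
    rw [intervalProj_apply_of_mem hNB.le ⟨h, he.2⟩, hne] at heB
    exact lt_irrefl _ heB
  obtain ⟨x, hx, hlt⟩ := (intervalProj N B * X * intervalProj N B).exists_lt_apply_of_lt_opNorm
    ((half_lt_self hc).trans_le (hX B hB hNB))
  obtain ⟨L₁, hL₁, hNL₁, hLB₁, h₁⟩ := hN.exists_le hB hNB (X (intervalProj N B x))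
    (show 0 < c / 8 by positivity)
  obtain ⟨L₂, hL₂, hNL₂, hLL, h₂⟩ := hN.exists_le hL₁ hNL₁ x
    (show 0 < c / (8 * (‖X‖ + 1)) by positivity)
  have hLB := hLL.trans hLB₁
  replace h₁ := (norm_intervalProj_apply_mono hNL₂.le hLL _).trans_lt h₁
  set u := intervalProj L₂ B x with hu
  set w := intervalProj L₂ B (X u) with hw
  have hu_eq : u = intervalProj N B x - intervalProj N L₂ x := by
    rw [← intervalProj_add_intervalProj N L₂ B x, add_sub_cancel_right]
  have hw_eq : w = intervalProj N B (X (intervalProj N B x)) -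
      intervalProj N L₂ (X (intervalProj N B x)) - intervalProj L₂ B (X (intervalProj N L₂ x)) := by
    rw [hw, hu_eq, map_sub, map_sub, ← intervalProj_add_intervalProj N L₂ B (X _),
      add_sub_cancel_right]
  have h₃ : ‖intervalProj L₂ B (X (intervalProj N L₂ x))‖ ≤ c / 8 := by
    refine (norm_intervalProj_apply_le hLB _).trans ((X.le_opNorm _).trans ?_)
    calc ‖X‖ * ‖intervalProj N L₂ x‖ ≤ (‖X‖ + 1) * (c / (8 * (‖X‖ + 1))) := by
          gcongr
          linarith
      _ = c / 8 := by field_simp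
  -- The main term exceeds `c / 2`, and each of the two truncations costs at most `c / 8`.
  have hwc : c / 4 ≤ ‖w‖ := by
    have h₄ : c / 2 < ‖intervalProj N B (X (intervalProj N B x))‖ := hlt
    have h₅ := norm_sub_norm_le (intervalProj N B (X (intervalProj N B x)))
      (intervalProj N L₂ (X (intervalProj N B x)))
    have h₆ := norm_sub_norm_le (intervalProj N B (X (intervalProj N B x)) -
      intervalProj N L₂ (X (intervalProj N B x))) (intervalProj L₂ B (X (intervalProj N L₂ x)))
    rw [← hw_eq] at h₆
    linarith
  have hw0 : 0 < ‖w‖ := lt_of_lt_of_le (by positivity) hwc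
  obtain ⟨L, hL, hNL, hLL₂, h₄⟩ := hN.exists_le hL₂ hNL₂ (X u) hε
  have hperp : ∀ {y : H}, y ∈ B ⊓ L₂ᗮ → y ∈ B ⊓ Lᗮ := fun hy =>
    ⟨hy.1, ClosedSubmodule.orthogonal_le hLL₂ hy.2⟩
  have hwm : w ∈ B ⊓ L₂ᗮ := intervalProj_mem hLB _
  -- Dividing `w` by `‖w‖ ^ 2` normalizes the pairing with `X u` to `1`, and the norm becomes `1 /
  -- ‖w‖ ≤ 4 / c`.
  refine ⟨⟨B, L, e, u, ((‖w‖ ^ 2)⁻¹ : ℂ) • w, hB, hL, hNL, hLL₂.trans hLB, hBM, ⟨he.1, heB'⟩, hne,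
    hat, hperp (intervalProj_mem hLB _), (norm_intervalProj_apply_le hLB x).trans hx.le,
    SMulMemClass.smul_mem _ (hperp hwm), ?_, ?_, h₄.le⟩⟩
  · rw [norm_smul, norm_inv, norm_pow, Complex.norm_real, norm_norm, sq, mul_inv, mul_assoc,
      inv_mul_cancel₀ hw0.ne', mul_one, inv_le_comm₀ hw0 (by positivity), inv_div]
    exact hwc
  · rw [inner_smul_left, ← inner_intervalProj hLB hwm (X u), ← hw, inner_self_eq_norm_sq_to_K]
    have : (‖w‖ : ℂ) ≠ 0 := by exact_mod_cast hw0.ne'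
    simp [this]

end Chain

/-! ### Projections onto spans of orthonormal sequences -/

section OrthogonalFamilies

variable {H : Type u} [NormedAddCommGroup H] [InnerProductSpace ℂ H]

theorem pairwise_inner_eq_zero_of_lt {f : ℕ → H} (h : ∀ i j, i < j → ⟪f j, f i⟫_ℂ = 0) :
    Pairwise fun i j => ⟪f i, f j⟫_ℂ = 0 := by
  intro i j hij
  rcases lt_or_gt_of_ne hij with hlt | hlt
  · exact inner_eq_zero_symm.1 (h i j hlt)
  · exact h j i hlt

theorem eq_of_hasSum_inner_smul {e f : ℕ → H} (he : Pairwise fun i j => ⟪e i, e j⟫_ℂ = 0)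
    (h1 : ∀ j, ‖e j‖ = 1) {j : ℕ} {y : H} (h : HasSum (fun i => ⟪e i, e j⟫_ℂ • f i) y) :
    y = f j := by
  refine h.unique ?_
  convert! hasSum_single (f := fun i => ⟪e i, e j⟫_ℂ • f i) j fun i hi => ?_
  · simp [inner_self_eq_norm_sq_to_K, h1]
  · rw [he hi, zero_smul]

variable [CompleteSpace H]

open Classical in
/-- The projection onto the closed span of part of an orthonormal sequence. -/
theorem exists_isStarProjection_hasSum {e : ℕ → H} (he : Pairwise fun i j => ⟪e i, e j⟫_ℂ = 0)
    (h1 : ∀ j, ‖e j‖ = 1) (τ : Set ℕ) :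
    ∃ q : H →L[ℂ] H, IsStarProjection q ∧
      ∀ x, HasSum (fun j => ⟪e j, x⟫_ℂ • if j ∈ τ then e j else 0) (q x) := by
  obtain ⟨q, hq, -⟩ := exists_hasSum_inner_smul (e := e) (f := fun j => if j ∈ τ then e j else 0)
    he (fun i j hij => by dsimp only; split_ifs <;> simp [he hij]) zero_le_one zero_le_one
    (fun j => (h1 j).le) (fun j => by split_ifs <;> simp [h1])
  refine ⟨q, ⟨?_, ?_⟩, hq⟩
  · ext x
    refine (q.hasSum (hq x)).unique ?_
    convert! hq x using 2 with j
    rw [map_smul]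
    congr 1
    split_ifs with hj
    · rw [eq_of_hasSum_inner_smul he h1 (hq (e j)), if_pos hj]
    · exact map_zero q
  · rw [ContinuousLinearMap.isSelfAdjoint_iff_isSymmetric]
    intro x y
    have hx := ((innerSL ℂ y).hasSum (hq x)).star
    have hy := (innerSL ℂ x).hasSum (hq y)
    simp only [innerSL_apply_apply, RCLike.star_def, inner_conj_symm] at hx hy
    refine hx.unique ?_
    convert! hy using 2 with j
    split_ifs <;> simp [inner_smul_left, inner_smul_right, mul_comm]

end OrthogonalFamilies

/-! ### The factorization along a sequence descending to the limit point -/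

section Chain

variable {H : Type u} [NormedAddCommGroup H] [InnerProductSpace ℂ H] [CompleteSpace H]
  {C : Set (ClosedSubmodule ℂ H)} {N : ClosedSubmodule ℂ H}

/-- Choose `K n` so that the `n`-th vector of a dense sequence has a component of norm below `1 / 2`
in the interval from `N` to `K n`. A unit vector above `N` inside `M` is within `1 / 2` of some
dense vector, so the corresponding `K n` cannot contain `M`. -/
theorem IsAtomicLimit.exists_seq [TopologicalSpace.SeparableSpace H] (hN : IsAtomicLimit C N) :
    ∃ K : ℕ → ClosedSubmodule ℂ H, (∀ n, K n ∈ C ∧ N < K n) ∧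
      ∀ M ∈ C, N < M → ∃ n, K n ≤ M := by
  choose K hK hNK hlt using fun n =>
    hN.exists_norm_lt (TopologicalSpace.denseSeq H n) (1 / 2) one_half_pos
  refine ⟨K, fun n => ⟨hK n, hNK n⟩, fun M hM hNM => ?_⟩
  obtain ⟨e, he, h1, -⟩ := hN.exists_unit M hM hNM
  obtain ⟨n, hn⟩ := (TopologicalSpace.denseRange_denseSeq H).exists_dist_lt e
    (one_half_pos (α := ℝ))
  refine ⟨n, (hN.le_or_le _ (hK n) _ hM).resolve_right fun hle => ?_⟩
  rw [dist_eq_norm] at hn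
  have h2 := norm_intervalProj_apply_le (hNK n).le (e - TopologicalSpace.denseSeq H n)
  rw [map_sub, intervalProj_apply_of_mem (hNK n).le ⟨hle he.1, he.2⟩] at h2
  have h3 := norm_sub_norm_le e (intervalProj N (K n) (TopologicalSpace.denseSeq H n))
  have h4 := hlt n
  linarith

theorem IsAtomicLimit.exists_links [TopologicalSpace.SeparableSpace H] (hN : IsAtomicLimit C N)
    {X : H →L[ℂ] H} {c : ℝ} (hc : 0 < c)
    (hX : ∀ M ∈ C, N < M → c ≤ ‖intervalProj N M * X * intervalProj N M‖) {ε : ℕ → ℝ}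
    (hε : ∀ n, 0 < ε n) :
    ∃ (M : ℕ → ClosedSubmodule ℂ H) (l : ∀ n, Link C N X (4 / c) (ε n) (M n)),
      (∀ n, M (n + 1) ≤ (l n).next) ∧ ∀ K ∈ C, N < K → ∃ n, ∀ m, n < m → M m ≤ K := by
  obtain ⟨K, hK, hcof⟩ := hN.exists_seq
  have hmin : ∀ (n : ℕ) (M : {M // M ∈ C ∧ N < M}), ∃ M' : {M // M ∈ C ∧ N < M},
      M'.1 ≤ M.1 ∧ M'.1 ≤ K n := by
    intro n M
    rcases hN.le_or_le _ M.2.1 _ (hK n).1 with h | h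
    · exact ⟨M, le_rfl, h⟩
    · exact ⟨⟨K n, hK n⟩, h, le_rfl⟩
  choose μ hμ hμK using hmin
  have hlink : ∀ (n : ℕ) (M : {M // M ∈ C ∧ N < M}), Nonempty (Link C N X (4 / c) (ε n) M.1) :=
    fun n M => hN.nonempty_link hc hX M.2.1 M.2.2 (hε n)
  let L : ∀ (n : ℕ) (M : {M // M ∈ C ∧ N < M}), Link C N X (4 / c) (ε n) M.1 :=
    fun n M => (hlink n M).some
  obtain ⟨M₀, hM₀⟩ := hN.exists_gt
  -- Each new link starts below the previous link and below `K n`, so the links descend past every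
  -- member of the chain above `N`.
  let M : ℕ → {M // M ∈ C ∧ N < M} := fun n => Nat.rec ⟨M₀, hM₀⟩
    (fun n M => μ n ⟨(L n M).next, (L n M).next_mem, (L n M).lt_next⟩) n
  have hM : ∀ n, (M (n + 1)).1 ≤ (L n (M n)).next := fun n => hμ n _
  have hanti : Antitone fun n => (M n).1 := antitone_nat_of_succ_le fun n =>
    (hM n).trans ((L n (M n)).next_le.trans (L n (M n)).mid_le)
  refine ⟨fun n => (M n).1, fun n => L n (M n), hM, fun K' hK' hNK' => ?_⟩
  obtain ⟨n, hn⟩ := hcof K' hK' hNK'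
  exact ⟨n, fun m hm => (hanti (Nat.succ_le_of_lt hm)).trans ((hμK n _).trans hn)⟩

/-- There are two projections `p` and `q` in the algebra of the chain, both large near `N`, such
that every corner `p Y q` factors through `X`. -/
theorem IsAtomicLimit.exists_factorization [TopologicalSpace.SeparableSpace H]
    (hN : IsAtomicLimit C N) {X : H →L[ℂ] H} (hXC : X ∈ invariantSubalgebra C) {c : ℝ} (hc : 0 < c)
    (hX : ∀ M ∈ C, N < M → c ≤ ‖intervalProj N M * X * intervalProj N M‖) :
    ∃ p ∈ invariantSubalgebra C, ∃ q ∈ invariantSubalgebra C,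
      IsStarProjection p ∧ IsStarProjection q ∧
      (∀ K ∈ C, N < K → ∃ e ∈ K ⊓ Nᗮ, ‖e‖ = 1 ∧ p e = e) ∧
      (∀ K ∈ C, N < K → ∃ e ∈ K ⊓ Nᗮ, ‖e‖ = 1 ∧ q e = e) ∧
      ∀ Y ∈ invariantSubalgebra C, ∃ Z ∈ invariantSubalgebra C, ∃ W ∈ invariantSubalgebra C,
        p * Y * q = Z * X * W := by
  classical
  set b := 4 / c with hb
  have hb0 : 0 < b := by positivity
  -- These errors, multiplied by the bound `b` for `‖V‖`, sum to `1 / 2`.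
  obtain ⟨M, l, hMl, hcof⟩ := hN.exists_links hc hX (ε := fun n => (1 / 2) ^ n / (4 * b))
    (fun n => by positivity)
  have hanti : Antitone M := antitone_nat_of_succ_le fun n =>
    (hMl n).trans ((l n).next_le.trans (l n).mid_le)
  have hlt : ∀ {i j}, i < j → M j ≤ (l i).next := fun {i j} h =>
    (hanti (Nat.succ_le_of_lt h)).trans (hMl i)
  have hmid : ∀ {i j}, i < j → (l j).mid ≤ (l i).next := fun {i j} h => (l j).mid_le.trans (hlt h)
  have hnext : ∀ {i j}, i ≤ j → (l j).next ≤ (l i).next := fun {i j} h => by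
    rcases h.eq_or_lt with rfl | h
    · exact le_rfl
    · exact (l j).next_le.trans (hmid h)
  set e : ℕ → H := fun j => (l j).e
  set u : ℕ → H := fun j => (l j).u
  set w : ℕ → H := fun j => (l j).w
  have he1 : ∀ j, ‖e j‖ = 1 := fun j => (l j).norm_e
  have he : Pairwise fun i j => ⟪e i, e j⟫_ℂ = 0 := pairwise_inner_eq_zero_of_lt fun i j h =>
    (l i).e_mem.2 _ ((l i).next_le (hlt h (l j).e_mem.1))
  have hu : Pairwise fun i j => ⟪u i, u j⟫_ℂ = 0 := pairwise_inner_eq_zero_of_lt fun i j h =>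
    (l i).u_mem.2 _ (hmid h (l j).u_mem.1)
  have hw : Pairwise fun i j => ⟪w i, w j⟫_ℂ = 0 := pairwise_inner_eq_zero_of_lt fun i j h =>
    (l i).w_mem.2 _ (hmid h (l j).w_mem.1)
  have hw_perp : ∀ {j y}, y ∈ (l j).next → ⟪w j, y⟫_ℂ = 0 := fun {j y} hy =>
    inner_eq_zero_symm.1 ((l j).w_mem.2 _ hy)
  have hproj : ∀ τ : Set ℕ, ∃ q : H →L[ℂ] H, q ∈ invariantSubalgebra C ∧ IsStarProjection q ∧
      (∀ x, HasSum (fun j => ⟪e j, x⟫_ℂ • if j ∈ τ then e j else 0) (q x)) ∧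
      ∀ j, q (e j) = if j ∈ τ then e j else 0 := by
    intro τ
    obtain ⟨q, hq, hqs⟩ := exists_isStarProjection_hasSum he he1 τ
    refine ⟨q, fun K hK x hx => mem_of_hasSum_mem (hqs x) fun j => ?_, hq, hqs,
      fun j => eq_of_hasSum_inner_smul he he1 (hqs (e j))⟩
    rcases (l j).e_mem_or K hK with h | h
    · refine SMulMemClass.smul_mem _ ?_
      split_ifs
      exacts [h, zero_mem K]
    · have : ⟪e j, x⟫_ℂ = 0 := inner_eq_zero_symm.1 (h _ hx)
      simp [this]
  have hlarge : ∀ (τ : Set ℕ) (q : H →L[ℂ] H), (∀ j, q (e j) = if j ∈ τ then e j else 0) →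
      (∀ n, ∃ m ∈ τ, n < m) → ∀ K ∈ C, N < K → ∃ e ∈ K ⊓ Nᗮ, ‖e‖ = 1 ∧ q e = e := by
    intro τ q hq hτ K hK hNK
    obtain ⟨n, hn⟩ := hcof K hK hNK
    obtain ⟨m, hm, hnm⟩ := hτ n
    refine ⟨e m, ⟨hn m hnm (l m).e_mem.1, ?_⟩, he1 m, by rw [hq, if_pos hm]⟩
    exact ClosedSubmodule.orthogonal_le ((l m).lt_next.le.trans (l m).next_le) (l m).e_mem.2
  have hmid_le : ∀ {j x}, ∀ K ∈ C, x ∈ K → ⟪e j, x⟫_ℂ ≠ 0 → (l j).mid ≤ K := by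
    intro j x K hK hx hne
    refine (hN.le_or_le _ (l j).mid_mem _ hK).resolve_right fun h => hne ?_
    exact inner_eq_zero_symm.1 ((l j).e_mem.2 _ (h hx))
  -- `W` sends `e j` to `u j`, further down the chain, so it lies in the algebra. `V` sends the
  -- direction of `w j` back up to `e j` and need not lie in it; it will be used only after
  -- multiplication by a corner `p * Y * q`.
  obtain ⟨W, hWs, -⟩ := exists_hasSum_inner_smul he hu zero_le_one zero_le_one
    (fun j => (he1 j).le) (fun j => (l j).norm_u)
  obtain ⟨V, hVs, hVb⟩ := exists_hasSum_inner_smul hw he hb0.le zero_le_one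
    (fun j => (l j).norm_w) (fun j => (he1 j).le)
  have hWC : W ∈ invariantSubalgebra C := by
    intro K hK x hx
    refine mem_of_hasSum_mem (hWs x) fun j => ?_
    by_cases h : ⟪e j, x⟫_ℂ = 0
    · simp [h]
    · exact SMulMemClass.smul_mem _ (hmid_le K hK hx h (l j).u_mem.1)
  -- Splitting the `e j` by parity removes the diagonal entries from `p * Y * q`.
  obtain ⟨p, hpC, hp, hps, hpe⟩ := hproj {j | Odd j}
  obtain ⟨q, hqC, hq, hqs, hqe⟩ := hproj {j | Even j}
  obtain ⟨s, -, -, hss, -⟩ := hproj Set.univ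
  simp only [Set.mem_univ, if_true] at hss
  set r : ℕ → H := fun j => V (intervalProj N (l j).next (X (u j))) with hr
  have hz : ∀ j, intervalProj N (l j).next (X (u j)) ∈ (l j).next := fun j =>
    (intervalProj_mem (l j).lt_next.le _).1
  have hVX : ∀ j, V (X (u j)) = e j + r j := by
    intro j
    have hy : X (u j) ∈ (l j).mid := hXC _ (l j).mid_mem _ (l j).u_mem.1
    -- After the tail in `next` is removed, only `w j` still pairs nontrivially with `X (u j)`: for
    -- `i < j` both vectors lie in a subspace orthogonal to `w i`, and for `i > j` the vector `w i`
    -- lies in the removed interval.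
    rw [← sub_eq_iff_eq_add, hr, ← map_sub]
    refine (hVs _).unique ?_
    convert! hasSum_single (f := fun i =>
      ⟪w i, X (u j) - intervalProj N (l j).next (X (u j))⟫_ℂ • e i) j fun i hi => ?_
    · rw [inner_sub_right, hw_perp (hz j), sub_zero]
      exact (by rw [(l j).inner_eq, one_smul] : e j = ⟪(l j).w, X (l j).u⟫_ℂ • e j)
    · rcases lt_or_gt_of_ne hi with h | h
      · rw [inner_sub_right, hw_perp (hmid h hy), hw_perp (hnext h.le (hz j)), sub_zero, zero_smul]
      · rw [inner_sub_right, inner_intervalProj (l j).lt_next.le, sub_self, zero_smul]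
        exact ⟨hmid h (l i).w_mem.1, ClosedSubmodule.orthogonal_le (l i).lt_next.le (l i).w_mem.2⟩
  have hrb : ∀ j, ‖r j‖ ≤ 1 / 4 * (1 / 2) ^ j := by
    intro j
    refine (V.le_opNorm _).trans ?_
    calc _ ≤ b * 1 * ((1 / 2) ^ j / (4 * b)) := by gcongr; exact (l j).norm_le
      _ = _ := by field_simp
  have hrK : ∀ j, r j ∈ (l j).mid := by
    intro j
    refine mem_of_hasSum_mem (hVs _) fun i => ?_
    rcases le_or_gt i j with h | h
    · rw [hw_perp (hnext h (hz j)), zero_smul]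
      exact zero_mem _
    · exact SMulMemClass.smul_mem _ ((l j).next_le (hlt h (l i).e_mem.1))
  -- `R` is the error in `V * X * W ≈ s`; it sends `e j` to `r j`.
  set R : H →L[ℂ] H := V * X * W - s with hR
  have hRs : ∀ x, HasSum (fun j => ⟪e j, x⟫_ℂ • r j) (R x) := by
    intro x
    have h := ((V * X).hasSum (hWs x)).sub (hss x)
    simp only [map_smul, ← smul_sub] at h
    have h2 : ∀ j, (V * X) (u j) - e j = r j := fun j => sub_eq_iff_eq_add'.2 (hVX j)
    simp only [h2] at h
    exact h
  have hRC : R ∈ invariantSubalgebra C := by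
    intro K hK x hx
    refine mem_of_hasSum_mem (hRs x) fun j => ?_
    by_cases h : ⟪e j, x⟫_ℂ = 0
    · simp [h]
    · exact SMulMemClass.smul_mem _ (hmid_le K hK hx h (hrK j))
  have hRb : ‖R‖ < 1 := by
    refine lt_of_le_of_lt (R.opNorm_le_bound (M := 1 / 2) (by norm_num) fun x => ?_) one_half_lt_one
    have h2 := (hasSum_geometric_two.mul_left (1 / 4)).mul_left ‖x‖
    refine (HasSum.norm_le_of_bounded (hRs x) h2 fun j => ?_).trans (by linarith)
    rw [norm_smul]
    gcongr
    · simpa [he1] using norm_inner_le_norm (𝕜 := ℂ) (e j) x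
    · exact hrb j
  obtain ⟨G, hG⟩ : ∃ G ∈ invariantSubalgebra C, (1 + R) * G = 1 := by
    have hu : IsUnit (1 - (-⟨R, hRC⟩ : invariantSubalgebra C)) :=
      isUnit_one_sub_of_norm_lt_one (by rw [norm_neg]; exact hRb)
    obtain ⟨G, hG⟩ := hu.exists_right_inv
    refine ⟨G, G.2, ?_⟩
    have := congrArg Subtype.val hG
    simpa using this
  have hqs' : q * s = q := by
    ext x
    refine (q.hasSum (hss x)).unique ?_
    convert! hqs x using 2 with j
    rw [map_smul, hqe]
  refine ⟨p, hpC, q, hqC, hp, hq,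
    hlarge _ p hpe fun n => ⟨2 * n + 1, ⟨n, rfl⟩, by omega⟩,
    hlarge _ q hqe fun n => ⟨2 * (n + 1), even_two_mul _, by omega⟩, fun Y hY => ?_⟩
  -- For even `i`, `Y (e i)` is orthogonal to `e k` when `k < i`, and parity excludes `k = i`. Only
  -- `e k` with `k > i` remain, and these lie in `(l i).next`.
  have hcorner : ∀ i, (p * Y * q) (e i) ∈ (l i).next := by
    intro i
    have : (p * Y * q) (e i) = p (Y (q (e i))) := rfl
    rw [this, hqe]
    split_ifs with hi
    · refine mem_of_hasSum_mem (hps _) fun k => ?_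
      rcases lt_trichotomy k i with h | h | h
      · have hYe : Y (e i) ∈ (l k).mid := (l k).next_le <|
          hY _ (l k).next_mem _ (hlt h (l i).e_mem.1)
        rw [inner_eq_zero_symm.1 ((l k).e_mem.2 _ hYe), zero_smul]
        exact zero_mem _
      · rw [if_neg, smul_zero]
        · exact zero_mem _
        · rw [h]
          exact Nat.not_odd_iff_even.2 hi
      · refine SMulMemClass.smul_mem _ ?_
        split_ifs
        exacts [hlt h (l k).e_mem.1, zero_mem _]
    · simp only [map_zero]
      exact zero_mem _
  -- Since `w i` is orthogonal to `(l i).next` and the corner maps `e i` into it, `p * Y * q * V`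
  -- lies in the algebra although `V` need not. The inverse `G` of `1 + R` absorbs the error.
  refine ⟨p * Y * q * V, fun K hK x hx => ?_, W * G, mul_mem hWC hG.1, ?_⟩
  · refine mem_of_hasSum_mem ((p * Y * q).hasSum (hVs x)) fun i => ?_
    rw [map_smul]
    rcases hN.le_or_le _ (l i).next_mem _ hK with h | h
    · exact SMulMemClass.smul_mem _ (h (hcorner i))
    · rw [hw_perp (h hx), zero_smul]
      exact zero_mem _
  · have h1 : V * X * W = s + R := by rw [hR]; abel
    have h2 : p * Y * q * (V * X * W) = p * Y * q * (1 + R) := by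
      rw [h1, mul_add, mul_add, mul_one, mul_assoc _ q s, hqs']
    calc p * Y * q = p * Y * q * ((1 + R) * G) := by rw [hG.2, mul_one]
      _ = p * Y * q * (V * X * W) * G := by rw [h2, mul_assoc _ (1 + R)]
      _ = _ := by simp only [mul_assoc]

end Chain

/-! ### Orthogonal complements, adjoints and limits of chains -/

section Orthogonal

variable {H : Type u} [NormedAddCommGroup H] [InnerProductSpace ℂ H] [CompleteSpace H]

theorem ClosedSubmodule.orthogonal_orthogonal' (K : ClosedSubmodule ℂ H) : Kᗮᗮ = K := by
  ext x
  exact SetLike.ext_iff.1 (Submodule.orthogonal_orthogonal K.toSubmodule) x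

theorem ClosedSubmodule.orthogonal_lt_orthogonal_iff {K L : ClosedSubmodule ℂ H} :
    Lᗮ < Kᗮ ↔ K < L := by
  have h : ∀ {K L : ClosedSubmodule ℂ H}, Lᗮ ≤ Kᗮ ↔ K ≤ L := fun {K L} =>
    ⟨fun h => by simpa only [ClosedSubmodule.orthogonal_orthogonal'] using
      ClosedSubmodule.orthogonal_le h, ClosedSubmodule.orthogonal_le⟩
  rw [lt_iff_le_not_ge, lt_iff_le_not_ge, h, h]

theorem Nest.intervalProj_orthogonal (M N : ClosedSubmodule ℂ H) :
    intervalProj Nᗮ Mᗮ = intervalProj M N := by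
  have h : ∀ K : ClosedSubmodule ℂ H,
      (Kᗮ).toSubmodule.starProjection = 1 - K.toSubmodule.starProjection :=
    fun K => Submodule.starProjection_orthogonal' K.toSubmodule
  rw [intervalProj, intervalProj, h, h]
  abel

theorem star_mem_invariantSubalgebra_image_orthogonal {C : Set (ClosedSubmodule ℂ H)}
    {T : H →L[ℂ] H} : star T ∈ invariantSubalgebra (ClosedSubmodule.orthogonal '' C) ↔
      T ∈ invariantSubalgebra C := by
  constructor
  · intro h K hK x hx
    rw [← ClosedSubmodule.orthogonal_orthogonal' K]
    intro y hy
    rw [← ContinuousLinearMap.adjoint_inner_left]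
    exact inner_eq_zero_symm.1 (h _ ⟨K, hK, rfl⟩ y hy x hx)
  · rintro h _ ⟨K, hK, rfl⟩ y hy x hx
    rw [ContinuousLinearMap.star_eq_adjoint, ContinuousLinearMap.adjoint_inner_right]
    exact hy _ (h K hK x hx)

/-- If `N` is the join of the members of a chain strictly below it, these converge to `N`. -/
theorem exists_norm_intervalProj_lt {C : Set (ClosedSubmodule ℂ H)} {N : ClosedSubmodule ℂ H}
    (hC : ∀ K ∈ C, ∀ L ∈ C, K ≤ L ∨ L ≤ K) (hne : ∃ M ∈ C, M < N)
    (hN : N ≤ sSup {M | M ∈ C ∧ M < N}) (x : H) {ε : ℝ} (hε : 0 < ε) :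
    ∃ M ∈ C, M < N ∧ ‖intervalProj M N x‖ < ε := by
  set y := N.toSubmodule.starProjection x with hy
  have hyS := hN (Submodule.starProjection_apply_mem N.toSubmodule x)
  rw [ClosedSubmodule.mem_sSup] at hyS
  obtain ⟨m, hm, hlt⟩ := Metric.mem_closure_iff.1 hyS ε hε
  obtain ⟨M₀, hM₀, hlt₀⟩ := hne
  -- The algebraic span of a chain is its union, so the approximant `m` lies in a single member `M`
  -- and is killed by `N - M`.
  have : ∃ M : ClosedSubmodule ℂ H, (M ∈ C ∧ M < N) ∧ m ∈ M := by
    have hm' : m ∈ ⨆ K ∈ {M | M ∈ C ∧ M < N}, K.toSubmodule := hm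
    rw [iSup_subtype'] at hm'
    have : Nonempty {M | M ∈ C ∧ M < N} := ⟨⟨M₀, hM₀, hlt₀⟩⟩
    rw [Submodule.mem_iSup_of_directed] at hm'
    · obtain ⟨M, hM⟩ := hm'
      exact ⟨M, M.2, hM⟩
    · intro K L
      rcases hC K K.2.1 L L.2.1 with h | h
      exacts [⟨L, h, le_rfl⟩, ⟨K, le_rfl, h⟩]
  obtain ⟨M, ⟨hM, hMN⟩, hmM⟩ := this
  refine ⟨M, hM, hMN, ?_⟩
  have h1 : intervalProj M N x = intervalProj M N (y - m) := by
    have h2 : intervalProj M N y = intervalProj M N x := by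
      have : intervalProj M N * N.toSubmodule.starProjection = intervalProj M N := by
        rw [intervalProj, sub_mul, proj_mul_of_le le_rfl, proj_mul_of_ge hMN.le]
      exact congrArg (fun T : H →L[ℂ] H => T x) this
    have h3 : intervalProj M N m = 0 := by
      rw [intervalProj, sub_apply,
        Submodule.starProjection_eq_self_iff.2 (hMN.le hmM : m ∈ N.toSubmodule),
        Submodule.starProjection_eq_self_iff.2 (hmM : m ∈ M.toSubmodule), sub_self]
    rw [map_sub, h2, h3, sub_zero]
  rw [h1]
  rw [dist_eq_norm] at hlt
  exact (norm_intervalProj_apply_le hMN.le _).trans_lt hlt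

end Orthogonal

/-! ### Atoms and limit points of an atomic nest -/

namespace Nest

variable {H : Type u} [NormedAddCommGroup H] [InnerProductSpace ℂ H]

theorem le_or_le (𝒩 : Nest H) (K : ClosedSubmodule ℂ H) (hK : K ∈ 𝒩.carrier)
    (L : ClosedSubmodule ℂ H) (hL : L ∈ 𝒩.carrier) : K ≤ L ∨ L ≤ K :=
  𝒩.isChain.total hK hL

/-- A member of the nest strictly inside the atom would cut off a smaller interval, against
minimality. -/
theorem le_or_le_orthogonal_of_mem_atoms {𝒩 : Nest H} {E : ClosedSubmodule ℂ H} (hE : E ∈ 𝒩.atoms)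
    {K : ClosedSubmodule ℂ H} (hK : K ∈ 𝒩) : E ≤ K ∨ E ≤ Kᗮ := by
  obtain ⟨⟨M, hM, N, hN, hMN, rfl⟩, hmin⟩ := hE
  rcases 𝒩.le_or_le K hK M hM with h | h
  · exact Or.inr (inf_le_right.trans (ClosedSubmodule.orthogonal_le h))
  rcases 𝒩.le_or_le N hN K hK with h' | h'
  · exact Or.inl (inf_le_left.trans h')
  rcases h.eq_or_lt with rfl | hlt
  · exact Or.inr inf_le_right
  · exact Or.inl ((hmin ⟨M, hM, K, hK, hlt, rfl⟩ (inf_le_inf_right _ h')).trans inf_le_left)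

theorem exists_norm_eq_one_of_ne_bot {E : ClosedSubmodule ℂ H} (h : E ≠ ⊥) :
    ∃ e ∈ E, ‖e‖ = 1 := by
  obtain ⟨x, hx, hx0⟩ : ∃ x ∈ E, x ≠ 0 := by
    by_contra! hE
    exact h (le_antisymm (fun x hx => hE x hx) bot_le)
  refine ⟨((‖x‖⁻¹ : ℝ) : ℂ) • x, SMulMemClass.smul_mem _ hx, ?_⟩
  rw [norm_smul, Complex.norm_real, norm_inv, norm_norm, inv_mul_cancel₀ (norm_ne_zero_iff.2 hx0)]

variable [CompleteSpace H]

theorem inf_orthogonal_ne_bot {M N : ClosedSubmodule ℂ H} (h : M < N) : N ⊓ Mᗮ ≠ ⊥ := by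
  intro hbot
  refine h.not_ge fun x hx => ?_
  have h1 := intervalProj_mem h.le x
  rw [hbot, ClosedSubmodule.mem_bot, intervalProj, sub_apply,
    Submodule.starProjection_eq_self_iff.2 (hx : x ∈ N.toSubmodule), sub_eq_zero] at h1
  exact Submodule.starProjection_eq_self_iff.1 h1.symm

/-- The atoms span `H`, so one of them is not orthogonal to the interval. No member of the nest
splits an atom, so this atom lies inside the interval. -/
theorem IsAtomic.exists_unit {𝒩 : Nest H} (h𝒩 : 𝒩.IsAtomic) {M N : ClosedSubmodule ℂ H}
    (hM : M ∈ 𝒩) (hN : N ∈ 𝒩) (h : M < N) :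
    ∃ e ∈ N ⊓ Mᗮ, ‖e‖ = 1 ∧ ∀ K ∈ 𝒩, e ∈ K ∨ e ∈ Kᗮ := by
  obtain ⟨E, hE, hEne⟩ : ∃ E ∈ 𝒩.atoms, ¬ E ≤ (N ⊓ Mᗮ)ᗮ := by
    by_contra! hall
    have htop : (⊤ : ClosedSubmodule ℂ H) ≤ (N ⊓ Mᗮ)ᗮ := by
      rw [← (h𝒩 : sSup 𝒩.atoms = ⊤)]
      exact sSup_le hall
    have := (ClosedSubmodule.orthogonal_eq_top_iff _).1 (top_le_iff.1 htop)
    exact inf_orthogonal_ne_bot h this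
  have hEN : E ≤ N := (le_or_le_orthogonal_of_mem_atoms hE hN).resolve_right fun h' =>
    hEne (h'.trans (ClosedSubmodule.orthogonal_le inf_le_left))
  have hEM : E ≤ Mᗮ := (le_or_le_orthogonal_of_mem_atoms hE hM).resolve_left fun h' => by
    refine hEne (h'.trans ?_)
    rw [← ClosedSubmodule.orthogonal_orthogonal' M]
    exact ClosedSubmodule.orthogonal_le (by
      rw [ClosedSubmodule.orthogonal_orthogonal' M]; exact inf_le_right)
  have hE0 : E ≠ ⊥ := by
    rintro rfl
    exact hEne bot_le
  obtain ⟨e, he, h1⟩ := exists_norm_eq_one_of_ne_bot hE0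
  refine ⟨e, ⟨hEN he, hEM he⟩, h1, fun K hK => ?_⟩
  rcases le_or_le_orthogonal_of_mem_atoms hE hK with h' | h'
  exacts [Or.inl (h' he), Or.inr (h' he)]

theorem IsAtomic.isAtomicLimit {𝒩 : Nest H} (h𝒩 : 𝒩.IsAtomic) {N : ClosedSubmodule ℂ H}
    (hN : N ∈ 𝒩) (htop : N < ⊤) (hlim : sInf {M | M ∈ 𝒩 ∧ N < M} ≤ N) :
    IsAtomicLimit 𝒩.carrier N where
  le_or_le := 𝒩.le_or_le
  exists_gt := ⟨⊤, 𝒩.top_mem, htop⟩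
  exists_norm_lt x ε hε := by
    have hchain : ∀ K ∈ ClosedSubmodule.orthogonal '' 𝒩.carrier,
        ∀ L ∈ ClosedSubmodule.orthogonal '' 𝒩.carrier, K ≤ L ∨ L ≤ K := by
      rintro _ ⟨K, hK, rfl⟩ _ ⟨L, hL, rfl⟩
      exact (𝒩.le_or_le L hL K hK).imp ClosedSubmodule.orthogonal_le ClosedSubmodule.orthogonal_le
    have hsup : Nᗮ ≤ sSup {M | M ∈ ClosedSubmodule.orthogonal '' 𝒩.carrier ∧ M < Nᗮ} := by
      rw [← ClosedSubmodule.orthogonal_orthogonal' (sSup _)]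
      refine ClosedSubmodule.orthogonal_le (le_trans (le_sInf fun M hM => ?_) hlim)
      rw [← ClosedSubmodule.orthogonal_orthogonal' M]
      exact ClosedSubmodule.orthogonal_le (le_sSup ⟨⟨M, hM.1, rfl⟩,
        ClosedSubmodule.orthogonal_lt_orthogonal_iff.2 hM.2⟩)
    obtain ⟨_, ⟨M, hM, rfl⟩, hlt, hx⟩ := exists_norm_intervalProj_lt hchain
      ⟨_, ⟨⊤, 𝒩.top_mem, rfl⟩, ClosedSubmodule.orthogonal_lt_orthogonal_iff.2 htop⟩ hsup x hε
    rw [intervalProj_orthogonal] at hx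
    exact ⟨M, hM, ClosedSubmodule.orthogonal_lt_orthogonal_iff.1 hlt, hx⟩
  exists_unit M hM hNM := h𝒩.exists_unit hN hM hNM

theorem IsAtomic.isAtomicLimit_orthogonal {𝒩 : Nest H} (h𝒩 : 𝒩.IsAtomic)
    {N : ClosedSubmodule ℂ H} (hN : N ∈ 𝒩) (hbot : ⊥ < N)
    (hlim : N ≤ sSup {M | M ∈ 𝒩 ∧ M < N}) :
    IsAtomicLimit (ClosedSubmodule.orthogonal '' 𝒩.carrier) Nᗮ where
  le_or_le := by
    rintro _ ⟨K, hK, rfl⟩ _ ⟨L, hL, rfl⟩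
    exact (𝒩.le_or_le L hL K hK).imp ClosedSubmodule.orthogonal_le ClosedSubmodule.orthogonal_le
  exists_gt := ⟨_, ⟨⊥, 𝒩.bot_mem, rfl⟩, ClosedSubmodule.orthogonal_lt_orthogonal_iff.2 hbot⟩
  exists_norm_lt x ε hε := by
    obtain ⟨M, hM, hlt, hx⟩ := exists_norm_intervalProj_lt 𝒩.le_or_le ⟨⊥, 𝒩.bot_mem, hbot⟩ hlim x hε
    exact ⟨_, ⟨M, hM, rfl⟩, ClosedSubmodule.orthogonal_lt_orthogonal_iff.2 hlt, by
      rwa [intervalProj_orthogonal]⟩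
  exists_unit := by
    rintro _ ⟨M, hM, rfl⟩ hNM
    rw [ClosedSubmodule.orthogonal_lt_orthogonal_iff] at hNM
    obtain ⟨e, he, h1, hat⟩ := h𝒩.exists_unit hM hN hNM
    refine ⟨e, ⟨he.2, by rw [ClosedSubmodule.orthogonal_orthogonal']; exact he.1⟩, h1, ?_⟩
    rintro _ ⟨K, hK, rfl⟩
    rw [ClosedSubmodule.orthogonal_orthogonal']
    exact (hat K hK).symm

end Nest

/-- A closed proper ideal which is prime; every primitive ideal of a Banach algebra is one. -/
structure IsClosedPrime {A : Type u} [NormedRing A] (P : TwoSidedIdeal A) : Prop where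
  mem_or_mem : ∀ {a b : A}, (∀ y, a * y * b ∈ P) → a ∈ P ∨ b ∈ P
  one_notMem : (1 : A) ∉ P
  mem_of_forall_norm_lt : ∀ {a : A}, (∀ ε > 0, ∃ y, a - y ∈ P ∧ ‖y‖ < ε) → a ∈ P

namespace Nest

/-- This supplies the rank-one operators on an atom. -/
theorem mem_algebra_of_covBy {H : Type u} [NormedAddCommGroup H]
    [InnerProductSpace ℂ H] {𝒩 : Nest H} {M N : ClosedSubmodule ℂ H} (hadj : ∀ K ∈ 𝒩, K ≤ N ∨ M ≤ K)
    {T : H →L[ℂ] H} (h₁ : ∀ x, T x ∈ M) (h₂ : ∀ x ∈ N, T x = 0) : T ∈ 𝒩.algebra := by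
  intro K hK x hx
  rcases hadj K hK with h | h
  · rw [h₂ x (h hx)]
    exact zero_mem K
  · exact h (h₁ x)

variable {H : Type u} [NormedAddCommGroup H] [InnerProductSpace ℂ H] [CompleteSpace H]
  {𝒩 : Nest H} {M N : ClosedSubmodule ℂ H}

/-! ### The diagonal ideals -/

theorem mem_upperIdeal_iff {hN : N ∈ 𝒩} {h : N < ⊤} {X : 𝒩.algebra} :
    X ∈ 𝒩.upperIdeal N hN h ↔ ∀ ε > 0, ∃ M ∈ 𝒩, N < M ∧
      ‖intervalProj N M * (X : H →L[ℂ] H) * intervalProj N M‖ < ε := by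
  rw [← upperSeminorm_eq_zero_iff 𝒩 h, upperIdeal, TwoSidedIdeal.mem_mk']
  rfl

theorem mem_lowerIdeal_iff {hN : N ∈ 𝒩} {h : ⊥ < N} {X : 𝒩.algebra} :
    X ∈ 𝒩.lowerIdeal N hN h ↔ ∀ ε > 0, ∃ M ∈ 𝒩, M < N ∧
      ‖intervalProj M N * (X : H →L[ℂ] H) * intervalProj M N‖ < ε := by
  rw [← lowerSeminorm_eq_zero_iff 𝒩 h, lowerIdeal, TwoSidedIdeal.mem_mk']
  rfl

theorem mem_upperIdeal_iff_of_covBy {hN : N ∈ 𝒩} {h : N < ⊤} (hM : M ∈ 𝒩) (hNM : N < M)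
    (hadj : ∀ K ∈ 𝒩, N < K → M ≤ K) {X : 𝒩.algebra} : X ∈ 𝒩.upperIdeal N hN h ↔
      intervalProj N M * (X : H →L[ℂ] H) * intervalProj N M = 0 := by
  rw [mem_upperIdeal_iff]
  constructor
  · refine fun hX => norm_le_zero_iff.1 (le_of_forall_pos_lt_add fun ε hε => ?_)
    obtain ⟨K, hK, hNK, hlt⟩ := hX ε hε
    rw [zero_add]
    exact (compress_mono le_rfl hNM.le (hadj K hK hNK) _).trans_lt hlt
  · exact fun hX ε hε => ⟨M, hM, hNM, by rwa [hX, norm_zero]⟩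

theorem mem_lowerIdeal_iff_of_covBy {hN : N ∈ 𝒩} {h : ⊥ < N} (hM : M ∈ 𝒩) (hMN : M < N)
    (hadj : ∀ K ∈ 𝒩, K < N → K ≤ M) {X : 𝒩.algebra} : X ∈ 𝒩.lowerIdeal N hN h ↔
      intervalProj M N * (X : H →L[ℂ] H) * intervalProj M N = 0 := by
  rw [mem_lowerIdeal_iff]
  constructor
  · refine fun hX => norm_le_zero_iff.1 (le_of_forall_pos_lt_add fun ε hε => ?_)
    obtain ⟨K, hK, hNK, hlt⟩ := hX ε hε
    rw [zero_add]
    exact (compress_mono (hadj K hK hNK) hMN.le le_rfl _).trans_lt hlt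
  · exact fun hX ε hε => ⟨M, hM, hMN, by rwa [hX, norm_zero]⟩

theorem upperIdeal_eq_lowerIdeal {hM : M ∈ 𝒩} {hN : N ∈ 𝒩} (h₁ : M < ⊤) (h₂ : ⊥ < N) (hMN : M < N)
    (hadj : ∀ K ∈ 𝒩, K ≤ M ∨ N ≤ K) : 𝒩.upperIdeal M hM h₁ = 𝒩.lowerIdeal N hN h₂ := by
  ext X
  rw [mem_upperIdeal_iff_of_covBy hN hMN fun K hK h => (hadj K hK).resolve_left h.not_ge,
    mem_lowerIdeal_iff_of_covBy hM hMN fun K hK h => (hadj K hK).resolve_right h.not_ge]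

/-- The projections of the nest, as elements of the nest algebra. -/
noncomputable def proj (hN : N ∈ 𝒩) : 𝒩.algebra :=
  ⟨N.toSubmodule.starProjection, fun K hK x hx => by
    rcases 𝒩.le_or_le N hN K hK with h | h
    · exact h (Submodule.starProjection_apply_mem _ x)
    · rwa [Submodule.starProjection_eq_self_iff.2 (h hx : x ∈ N.toSubmodule)]⟩

theorem coe_proj (hN : N ∈ 𝒩) : (proj hN : H →L[ℂ] H) = N.toSubmodule.starProjection := rfl

theorem proj_mul_proj (hM : M ∈ 𝒩) (hN : N ∈ 𝒩) (h : M ≤ N) : proj hM * proj hN = proj hM :=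
  Subtype.ext (proj_mul_of_ge h)

theorem mul_proj (hN : N ∈ 𝒩) (X : 𝒩.algebra) : proj hN * X * proj hN = X * proj hN :=
  Subtype.ext (algebra_mul_proj 𝒩 hN X)

theorem proj_mem_upperIdeal (hN : N ∈ 𝒩) (h : N < ⊤) : proj hN ∈ 𝒩.upperIdeal N hN h := by
  refine mem_upperIdeal_iff.2 fun ε hε => ⟨⊤, 𝒩.top_mem, h, ?_⟩
  rw [coe_proj, intervalProj, sub_mul, proj_mul_of_le le_rfl, proj_mul_of_le h.le, sub_self,
    zero_mul, norm_zero]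
  exact hε

theorem one_sub_proj_mem_upperIdeal (hN : N ∈ 𝒩) (h : N < ⊤) (hM : M ∈ 𝒩) (hNM : N < M) :
    1 - proj hM ∈ 𝒩.upperIdeal N hN h := by
  refine mem_upperIdeal_iff.2 fun ε hε => ⟨M, hM, hNM, ?_⟩
  have : intervalProj N M * ((1 - proj hM : 𝒩.algebra) : H →L[ℂ] H) = 0 := by
    rw [AddSubgroupClass.coe_sub, OneMemClass.coe_one, coe_proj, mul_sub, mul_one, intervalProj,
      sub_mul, proj_mul_of_le le_rfl, proj_mul_of_ge hNM.le, sub_self]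
  rw [this, zero_mul, norm_zero]
  exact hε

theorem one_sub_proj_mem_lowerIdeal (hN : N ∈ 𝒩) (h : ⊥ < N) :
    1 - proj hN ∈ 𝒩.lowerIdeal N hN h := by
  refine mem_lowerIdeal_iff.2 fun ε hε => ⟨⊥, 𝒩.bot_mem, h, ?_⟩
  have : intervalProj ⊥ N * ((1 - proj hN : 𝒩.algebra) : H →L[ℂ] H) = 0 := by
    rw [AddSubgroupClass.coe_sub, OneMemClass.coe_one, coe_proj, mul_sub, mul_one, intervalProj,
      sub_mul, proj_mul_of_le le_rfl, proj_mul_of_ge bot_le, sub_self]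
  rw [this, zero_mul, norm_zero]
  exact hε

theorem proj_mem_lowerIdeal (hN : N ∈ 𝒩) (h : ⊥ < N) (hM : M ∈ 𝒩) (hMN : M < N) :
    proj hM ∈ 𝒩.lowerIdeal N hN h := by
  refine mem_lowerIdeal_iff.2 fun ε hε => ⟨M, hM, hMN, ?_⟩
  rw [coe_proj, intervalProj, sub_mul, proj_mul_of_le le_rfl, proj_mul_of_le hMN.le, sub_self,
    zero_mul, norm_zero]
  exact hε

/-! ### The diagonal ideal contained in a closed prime ideal -/

variable {P : TwoSidedIdeal 𝒩.algebra}

theorem proj_mem_or (hP : IsClosedPrime P) (hN : N ∈ 𝒩) : proj hN ∈ P ∨ 1 - proj hN ∈ P := by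
  refine (hP.mem_or_mem fun y => ?_).symm
  rw [sub_mul, one_mul, sub_mul, mul_proj, sub_self]
  exact P.zero_mem

/-- If `N ≤ M`, then `N = N M` lies in `P`, and so does `1 = (1 - N) + N`. -/
theorem lt_of_proj_mem (hP : IsClosedPrime P) (hM : M ∈ 𝒩) (hN : N ∈ 𝒩) (h₁ : proj hM ∈ P)
    (h₂ : 1 - proj hN ∈ P) : M < N := by
  by_contra hlt
  have hle : N ≤ M := by
    rcases 𝒩.le_or_le M hM N hN with h | h
    · exact (eq_of_le_of_not_lt h hlt).ge
    · exact h
  have := P.add_mem h₂ (P.mul_mem_left (proj hN) _ h₁)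
  rw [proj_mul_proj hN hM hle, sub_add_cancel] at this
  exact hP.one_notMem this

/-- An element is congruent to its compression to an interval, modulo an ideal containing the
complement of the interval. -/
theorem sub_compress_mem {P : TwoSidedIdeal 𝒩.algebra} (hM : M ∈ 𝒩) (hN : N ∈ 𝒩)
    (h₁ : proj hM ∈ P) (h₂ : 1 - proj hN ∈ P) (X : 𝒩.algebra) :
    X - (proj hN - proj hM) * X * (proj hN - proj hM) ∈ P := by
  have h : 1 - (proj hN - proj hM) ∈ P := by
    rw [sub_sub_eq_add_sub, add_sub_right_comm]
    exact P.add_mem h₂ h₁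
  -- With `e` the interval projection, `X - e X e = (1 - e) X + e X (1 - e)`.
  have h' := P.add_mem (P.mul_mem_right _ X h)
    (P.mul_mem_left ((proj hN - proj hM) * X) _ h)
  convert! h' using 1
  rw [sub_mul 1 (_ - _) X, one_mul, mul_sub _ 1 (_ - _), mul_one]
  abel

theorem upperIdeal_le (hP : IsClosedPrime P) (hN : N ∈ 𝒩) (h : N < ⊤) (hNP : proj hN ∈ P)
    (hMP : ∀ M (hM : M ∈ 𝒩), N < M → 1 - proj hM ∈ P) : 𝒩.upperIdeal N hN h ≤ P := by
  intro X hX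
  refine hP.mem_of_forall_norm_lt fun ε hε => ?_
  obtain ⟨M, hM, hNM, hlt⟩ := mem_upperIdeal_iff.1 hX ε hε
  exact ⟨_, sub_compress_mem hN hM hNP (hMP M hM hNM) X, hlt⟩

theorem lowerIdeal_le (hP : IsClosedPrime P) (hN : N ∈ 𝒩) (h : ⊥ < N) (hNP : 1 - proj hN ∈ P)
    (hMP : ∀ M (hM : M ∈ 𝒩), M < N → proj hM ∈ P) : 𝒩.lowerIdeal N hN h ≤ P := by
  intro X hX
  refine hP.mem_of_forall_norm_lt fun ε hε => ?_
  obtain ⟨M, hM, hMN, hlt⟩ := mem_lowerIdeal_iff.1 hX ε hε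
  exact ⟨_, sub_compress_mem hM hN (hMP M hM hMN) hNP X, hlt⟩

theorem exists_isDiagonalIdeal_le (hP : IsClosedPrime P) : ∃ I, 𝒩.IsDiagonalIdeal I ∧ I ≤ P := by
  set S : Set (ClosedSubmodule ℂ H) := {N | ∃ hN : N ∈ 𝒩, proj hN ∈ P} with hS
  have ha : sSup S ∈ 𝒩 := 𝒩.sSup_mem S fun N hN => hN.1
  rcases proj_mem_or hP ha with haP | haP
  · have htop : sSup S < ⊤ := by
      refine lt_top_iff_ne_top.2 fun h => hP.one_notMem ?_
      have : proj ha = 1 := Subtype.ext <| by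
        rw [coe_proj, h]
        exact Submodule.starProjection_top'
      rwa [← this]
    refine ⟨_, Or.inl ⟨_, ha, htop, rfl⟩, upperIdeal_le hP ha htop haP fun M hM hlt => ?_⟩
    exact (proj_mem_or hP hM).resolve_left fun h => hlt.not_ge (le_sSup ⟨hM, h⟩)
  · have hbot : ⊥ < sSup S := by
      refine bot_lt_iff_ne_bot.2 fun h => hP.one_notMem ?_
      have : 1 - proj ha = 1 := Subtype.ext <| by
        rw [AddSubgroupClass.coe_sub, coe_proj, h]
        change 1 - (⊥ : Submodule ℂ H).starProjection = 1
        rw [Submodule.starProjection_bot, sub_zero]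
      rwa [← this]
    refine ⟨_, Or.inr ⟨_, ha, hbot, rfl⟩, lowerIdeal_le hP ha hbot haP fun M hM hlt => ?_⟩
    exact (proj_mem_or hP hM).resolve_right fun h =>
      hlt.not_ge (sSup_le fun N ⟨hN, hNP⟩ => (lt_of_proj_mem hP hN hM hNP h).le)

/-- A member `K` strictly between `M` and `N` would have both `K` and `1 - K` in `P`. Hence `M` and
`N` are adjacent, and both ideals consist of the operators with zero compression to the same atom.
-/
theorem upperIdeal_eq_lowerIdeal_of_le (hP : IsClosedPrime P) {hM : M ∈ 𝒩} {hN : N ∈ 𝒩}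
    {h₁ : M < ⊤} {h₂ : ⊥ < N} (hMP : 𝒩.upperIdeal M hM h₁ ≤ P)
    (hNP : 𝒩.lowerIdeal N hN h₂ ≤ P) : 𝒩.upperIdeal M hM h₁ = 𝒩.lowerIdeal N hN h₂ := by
  refine upperIdeal_eq_lowerIdeal h₁ h₂ (lt_of_proj_mem hP hM hN
    (hMP (proj_mem_upperIdeal hM h₁)) (hNP (one_sub_proj_mem_lowerIdeal hN h₂))) fun K hK => ?_
  by_contra! hK'
  have hMK : M < K := lt_of_le_not_ge ((𝒩.le_or_le M hM K hK).resolve_right hK'.1) hK'.1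
  have hKN : K < N := lt_of_le_not_ge ((𝒩.le_or_le K hK N hN).resolve_right hK'.2) hK'.2
  exact lt_irrefl K (lt_of_proj_mem hP hK hK (hNP (proj_mem_lowerIdeal hN h₂ hK hKN))
    (hMP (one_sub_proj_mem_upperIdeal hM h₁ hK hMK)))

theorem le_of_upperIdeal_le (hP : IsClosedPrime P) {hM : M ∈ 𝒩} {hN : N ∈ 𝒩}
    {h₁ : M < ⊤} {h₂ : N < ⊤} (hMP : 𝒩.upperIdeal M hM h₁ ≤ P)
    (hNP : 𝒩.upperIdeal N hN h₂ ≤ P) : M ≤ N := by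
  by_contra hle
  have hlt : N < M := lt_of_le_not_ge ((𝒩.le_or_le M hM N hN).resolve_left hle) hle
  exact lt_irrefl M (lt_of_proj_mem hP hM hM (hMP (proj_mem_upperIdeal hM h₁))
    (hNP (one_sub_proj_mem_upperIdeal hN h₂ hM hlt)))

theorem le_of_lowerIdeal_le (hP : IsClosedPrime P) {hM : M ∈ 𝒩} {hN : N ∈ 𝒩}
    {h₁ : ⊥ < M} {h₂ : ⊥ < N} (hMP : 𝒩.lowerIdeal M hM h₁ ≤ P)
    (hNP : 𝒩.lowerIdeal N hN h₂ ≤ P) : M ≤ N := by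
  by_contra hle
  have hlt : N < M := lt_of_le_not_ge ((𝒩.le_or_le M hM N hN).resolve_left hle) hle
  exact lt_irrefl N (lt_of_proj_mem hP hN hN (hMP (proj_mem_lowerIdeal hM h₁ hN hlt))
    (hNP (one_sub_proj_mem_lowerIdeal hN h₂)))

theorem eq_of_isDiagonalIdeal_of_le (hP : IsClosedPrime P) {I J : TwoSidedIdeal 𝒩.algebra}
    (hI : 𝒩.IsDiagonalIdeal I) (hJ : 𝒩.IsDiagonalIdeal J) (hIP : I ≤ P) (hJP : J ≤ P) : I = J := by
  rcases hI with ⟨M, hM, h₁, rfl⟩ | ⟨M, hM, h₁, rfl⟩ <;>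
    rcases hJ with ⟨N, hN, h₂, rfl⟩ | ⟨N, hN, h₂, rfl⟩
  · obtain rfl := le_antisymm (le_of_upperIdeal_le hP hIP hJP) (le_of_upperIdeal_le hP hJP hIP)
    rfl
  · exact upperIdeal_eq_lowerIdeal_of_le hP hIP hJP
  · exact (upperIdeal_eq_lowerIdeal_of_le hP hJP hIP).symm
  · obtain rfl := le_antisymm (le_of_lowerIdeal_le hP hIP hJP) (le_of_lowerIdeal_le hP hJP hIP)
    rfl

/-! ### Projections in a closed prime ideal -/

theorem one_le_norm_compress (h : M ≤ N) {q : H →L[ℂ] H} {e : H} (he : e ∈ N ⊓ Mᗮ) (h1 : ‖e‖ = 1)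
    (hq : q e = e) : 1 ≤ ‖intervalProj M N * q * intervalProj M N‖ := by
  have h2 := (intervalProj M N * q * intervalProj M N).le_opNorm e
  have h3 : (intervalProj M N * q * intervalProj M N) e = e := by
    change intervalProj M N (q (intervalProj M N e)) = e
    rw [intervalProj_apply_of_mem h he, hq, intervalProj_apply_of_mem h he]
  rwa [h3, h1, mul_one] at h2

theorem notMem_upperIdeal {hN : N ∈ 𝒩} {h : N < ⊤} {q : 𝒩.algebra} (hq : ∀ K ∈ 𝒩, N < K →
    ∃ e ∈ K ⊓ Nᗮ, ‖e‖ = 1 ∧ (q : H →L[ℂ] H) e = e) : q ∉ 𝒩.upperIdeal N hN h := by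
  intro hmem
  obtain ⟨K, hK, hNK, hlt⟩ := mem_upperIdeal_iff.1 hmem 1 one_pos
  obtain ⟨e, he, h1, hqe⟩ := hq K hK hNK
  exact hlt.not_ge (one_le_norm_compress hNK.le he h1 hqe)

theorem notMem_lowerIdeal {hN : N ∈ 𝒩} {h : ⊥ < N} {q : 𝒩.algebra} (hq : ∀ K ∈ 𝒩, K < N →
    ∃ e ∈ N ⊓ Kᗮ, ‖e‖ = 1 ∧ (q : H →L[ℂ] H) e = e) : q ∉ 𝒩.lowerIdeal N hN h := by
  intro hmem
  obtain ⟨K, hK, hKN, hlt⟩ := mem_lowerIdeal_iff.1 hmem 1 one_pos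
  obtain ⟨e, he, h1, hqe⟩ := hq K hK hKN
  exact hlt.not_ge (one_le_norm_compress hKN.le he h1 hqe)

/-- An ideal containing an operator with nonzero compression to an atom contains a projection of
rank one onto a line in the atom. -/
theorem exists_isStarProjection_of_covBy {P : TwoSidedIdeal 𝒩.algebra} (hNM : N < M)
    (hadj : ∀ K ∈ 𝒩, K ≤ N ∨ M ≤ K) {X : 𝒩.algebra} (hX : X ∈ P)
    (hX0 : intervalProj N M * (X : H →L[ℂ] H) * intervalProj N M ≠ 0) :
    ∃ p : 𝒩.algebra, IsStarProjection (p : H →L[ℂ] H) ∧ p ∈ P ∧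
      intervalProj N M * (p : H →L[ℂ] H) * intervalProj N M ≠ 0 := by
  obtain ⟨x, hx⟩ : ∃ x, intervalProj N M ((X : H →L[ℂ] H) (intervalProj N M x)) ≠ 0 := by
    by_contra! h
    exact hX0 (ContinuousLinearMap.ext h)
  set v := intervalProj N M x with hv
  set w := intervalProj N M ((X : H →L[ℂ] H) v) with hw
  have hvm : v ∈ M ⊓ Nᗮ := intervalProj_mem hNM.le x
  have hwm : w ∈ M ⊓ Nᗮ := intervalProj_mem hNM.le _
  have hv0 : v ≠ 0 := by
    intro h
    rw [hw, h, map_zero, map_zero] at hx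
    exact hx rfl
  have hpC : (ℂ ∙ v).starProjection ∈ 𝒩.algebra := by
    refine mem_algebra_of_covBy hadj (fun y => ?_) fun y hy => ?_
    · obtain ⟨c, hc⟩ := Submodule.mem_span_singleton.1
        (Submodule.starProjection_apply_mem (ℂ ∙ v) y)
      rw [← hc]
      exact SMulMemClass.smul_mem _ hvm.1
    · rw [Submodule.starProjection_apply_eq_zero_iff,
        Submodule.mem_orthogonal_singleton_iff_inner_right]
      exact inner_eq_zero_symm.1 (hvm.2 y hy)
  -- `Z` is the rank-one operator taking `X v` back to `v`, so the projection onto the line of `v`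
  -- equals `Z * X` times itself.
  set Z : H →L[ℂ] H := ((‖w‖ ^ 2)⁻¹ : ℂ) • (innerSL ℂ w).smulRight v with hZ
  have hZC : Z ∈ 𝒩.algebra := by
    refine mem_algebra_of_covBy hadj (fun y => ?_) fun y hy => ?_
    · exact SMulMemClass.smul_mem _ (SMulMemClass.smul_mem _ hvm.1)
    · have : ⟪w, y⟫_ℂ = 0 := inner_eq_zero_symm.1 (hwm.2 y hy)
      simp [hZ, this]
  have hpv : (ℂ ∙ v).starProjection v = v :=
    Submodule.starProjection_eq_self_iff.2 (Submodule.mem_span_singleton_self v)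
  have hw0 : (‖w‖ : ℂ) ≠ 0 := by exact_mod_cast (norm_ne_zero_iff.2 hx)
  have hZX : Z ((X : H →L[ℂ] H) v) = v := by
    have : ⟪w, (X : H →L[ℂ] H) v⟫_ℂ = (‖w‖ : ℂ) ^ 2 := by
      rw [← inner_intervalProj hNM.le hwm, ← hw, inner_self_eq_norm_sq_to_K]
      rfl
    simp [hZ, this, smul_smul, hw0]
  refine ⟨⟨_, hpC⟩, isStarProjection_starProjection, ?_, fun h => ?_⟩
  · have hmem := P.mul_mem_right _ ⟨_, hpC⟩ (P.mul_mem_left ⟨Z, hZC⟩ X hX)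
    convert! hmem using 1
    refine Subtype.ext (ContinuousLinearMap.ext fun y => ?_)
    obtain ⟨c, hc⟩ := Submodule.mem_span_singleton.1
      (Submodule.starProjection_apply_mem (ℂ ∙ v) y)
    change (ℂ ∙ v).starProjection y = Z ((X : H →L[ℂ] H) ((ℂ ∙ v).starProjection y))
    rw [← hc, map_smul, map_smul, hZX]
  · have h' := congrArg (fun T : H →L[ℂ] H => T v) h
    change intervalProj N M ((ℂ ∙ v).starProjection (intervalProj N M v)) = 0 at h'
    rw [intervalProj_apply_of_mem hNM.le hvm, hpv, intervalProj_apply_of_mem hNM.le hvm] at h'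
    exact hv0 h'

theorem mem_or_mem_of_factorization (hP : IsClosedPrime P) {X p q : 𝒩.algebra} (hX : X ∈ P)
    (h : ∀ Y : 𝒩.algebra, ∃ Z W : 𝒩.algebra, p * Y * q = Z * X * W) : p ∈ P ∨ q ∈ P := by
  refine hP.mem_or_mem fun Y => ?_
  obtain ⟨Z, W, hZW⟩ := h Y
  rw [hZW]
  exact P.mul_mem_right _ _ (P.mul_mem_left _ _ hX)

/-! ### Projections at limit points and the conclusion -/

variable [TopologicalSpace.SeparableSpace H]

theorem IsAtomic.exists_isStarProjection_upper_limit (h𝒩 : 𝒩.IsAtomic) (hP : IsClosedPrime P)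
    {hN : N ∈ 𝒩} {htop : N < ⊤} (hlim : sInf {M | M ∈ 𝒩 ∧ N < M} ≤ N) {X : 𝒩.algebra} (hX : X ∈ P)
    (hXI : X ∉ 𝒩.upperIdeal N hN htop) :
    ∃ p : 𝒩.algebra, IsStarProjection (p : H →L[ℂ] H) ∧ p ∈ P ∧ p ∉ 𝒩.upperIdeal N hN htop := by
  rw [mem_upperIdeal_iff] at hXI
  push Not at hXI
  obtain ⟨c, hc, hXc⟩ := hXI
  obtain ⟨p, hpC, q, hqC, hp, hq, hpl, hql, hfac⟩ :=
    (h𝒩.isAtomicLimit hN htop hlim).exists_factorization X.2 hc hXc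
  rcases mem_or_mem_of_factorization hP (p := ⟨p, hpC⟩) (q := ⟨q, hqC⟩) hX fun Y => by
    obtain ⟨Z, hZ, W, hW, h⟩ := hfac Y Y.2
    exact ⟨⟨Z, hZ⟩, ⟨W, hW⟩, Subtype.ext h⟩ with h | h
  exacts [⟨_, hp, h, notMem_upperIdeal hpl⟩, ⟨_, hq, h, notMem_upperIdeal hql⟩]

theorem IsAtomic.exists_isStarProjection_lower_limit (h𝒩 : 𝒩.IsAtomic) (hP : IsClosedPrime P)
    {hN : N ∈ 𝒩} {hbot : ⊥ < N} (hlim : N ≤ sSup {M | M ∈ 𝒩 ∧ M < N}) {X : 𝒩.algebra} (hX : X ∈ P)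
    (hXI : X ∉ 𝒩.lowerIdeal N hN hbot) :
    ∃ p : 𝒩.algebra, IsStarProjection (p : H →L[ℂ] H) ∧ p ∈ P ∧ p ∉ 𝒩.lowerIdeal N hN hbot := by
  rw [mem_lowerIdeal_iff] at hXI
  push Not at hXI
  obtain ⟨c, hc, hXc⟩ := hXI
  have hXc' : ∀ M ∈ ClosedSubmodule.orthogonal '' 𝒩.carrier, Nᗮ < M →
      c ≤ ‖intervalProj Nᗮ M * star (X : H →L[ℂ] H) * intervalProj Nᗮ M‖ := by
    rintro _ ⟨M, hM, rfl⟩ hlt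
    rw [ClosedSubmodule.orthogonal_lt_orthogonal_iff] at hlt
    have hsa : star (intervalProj M N) = intervalProj M N := by
      rw [intervalProj_eq hlt.le]
      exact isStarProjection_starProjection.isSelfAdjoint
    rw [intervalProj_orthogonal, ← norm_star]
    simp only [star_mul, star_star, hsa, ← mul_assoc]
    exact hXc M hM hlt
  obtain ⟨p, hpC, q, hqC, hp, hq, hpl, hql, hfac⟩ :=
    (h𝒩.isAtomicLimit_orthogonal hN hbot hlim).exists_factorization
      (star_mem_invariantSubalgebra_image_orthogonal.2 X.2) hc hXc'
  have hps : star p = p := hp.isSelfAdjoint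
  have hqs : star q = q := hq.isSelfAdjoint
  have hpC' : p ∈ 𝒩.algebra := star_mem_invariantSubalgebra_image_orthogonal.1 (by rwa [hps])
  have hqC' : q ∈ 𝒩.algebra := star_mem_invariantSubalgebra_image_orthogonal.1 (by rwa [hqs])
  have hlarge : ∀ r : H →L[ℂ] H, (∀ K ∈ ClosedSubmodule.orthogonal '' 𝒩.carrier, Nᗮ < K →
      ∃ e ∈ K ⊓ Nᗮᗮ, ‖e‖ = 1 ∧ r e = e) → ∀ K ∈ 𝒩, K < N → ∃ e ∈ N ⊓ Kᗮ, ‖e‖ = 1 ∧ r e = e := by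
    intro r hr K hK hKN
    obtain ⟨e, he, h⟩ := hr _ ⟨K, hK, rfl⟩ (ClosedSubmodule.orthogonal_lt_orthogonal_iff.2 hKN)
    rw [ClosedSubmodule.orthogonal_orthogonal'] at he
    exact ⟨e, ⟨he.2, he.1⟩, h⟩
  -- Taking adjoints reverses products, so `p` and `q` exchange roles, as do `Z` and `W`.
  rcases mem_or_mem_of_factorization hP (p := ⟨q, hqC'⟩) (q := ⟨p, hpC'⟩) hX fun Y => by
    obtain ⟨Z, hZ, W, hW, h⟩ := hfac (star Y) (star_mem_invariantSubalgebra_image_orthogonal.2 Y.2)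
    refine ⟨⟨star W, star_mem_invariantSubalgebra_image_orthogonal.1 (by rwa [star_star])⟩,
      ⟨star Z, star_mem_invariantSubalgebra_image_orthogonal.1 (by rwa [star_star])⟩,
      Subtype.ext ?_⟩
    have h' := congrArg star h
    simp only [star_mul, star_star, hps, hqs, ← mul_assoc] at h'
    exact h' with h | h
  exacts [⟨_, hq, h, notMem_lowerIdeal (hlarge q hql)⟩,
    ⟨_, hp, h, notMem_lowerIdeal (hlarge p hpl)⟩]

theorem IsAtomic.exists_isStarProjection (h𝒩 : 𝒩.IsAtomic) (hP : IsClosedPrime P)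
    {I : TwoSidedIdeal 𝒩.algebra} (hI : 𝒩.IsDiagonalIdeal I) {X : 𝒩.algebra} (hX : X ∈ P)
    (hXI : X ∉ I) : ∃ p : 𝒩.algebra, IsStarProjection (p : H →L[ℂ] H) ∧ p ∈ P ∧ p ∉ I := by
  rcases hI with ⟨N, hN, h, rfl⟩ | ⟨N, hN, h, rfl⟩
  · set M := sInf {M | M ∈ 𝒩 ∧ N < M}
    have hM : M ∈ 𝒩 := 𝒩.sInf_mem _ fun M hM => hM.1
    have hNM : N ≤ M := le_sInf fun K hK => hK.2.le
    rcases hNM.eq_or_lt with heq | hlt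
    · exact h𝒩.exists_isStarProjection_upper_limit hP heq.ge hX hXI
    · have hadj : ∀ K ∈ 𝒩, N < K → M ≤ K := fun K hK hNK => sInf_le ⟨hK, hNK⟩
      simp only [mem_upperIdeal_iff_of_covBy hM hlt hadj] at hXI ⊢
      refine exists_isStarProjection_of_covBy hlt (fun K hK => ?_) hX hXI
      rcases 𝒩.le_or_le K hK N hN with h' | h'
      · exact Or.inl h'
      · exact h'.eq_or_lt.imp (fun h => h.ge) (hadj K hK)
  · set M := sSup {M | M ∈ 𝒩 ∧ M < N}
    have hM : M ∈ 𝒩 := 𝒩.sSup_mem _ fun M hM => hM.1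
    have hMN : M ≤ N := sSup_le fun K hK => hK.2.le
    rcases hMN.eq_or_lt with heq | hlt
    · exact h𝒩.exists_isStarProjection_lower_limit hP heq.ge hX hXI
    · have hadj : ∀ K ∈ 𝒩, K < N → K ≤ M := fun K hK hKN => le_sSup ⟨hK, hKN⟩
      simp only [mem_lowerIdeal_iff_of_covBy hM hlt hadj] at hXI ⊢
      refine exists_isStarProjection_of_covBy hlt (fun K hK => ?_) hX hXI
      rcases 𝒩.le_or_le N hN K hK with h' | h'
      · exact Or.inr h'
      · exact (h'.eq_or_lt.imp (fun h => h.ge) (hadj K hK)).symm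

end Nest

theorem mainTheorem9 {H : Type u} [NormedAddCommGroup H] [InnerProductSpace ℂ H] [CompleteSpace H]
    [TopologicalSpace.SeparableSpace H] (𝒩 : Nest H) (h𝒩 : 𝒩.IsAtomic)
    (P : TwoSidedIdeal 𝒩.algebra) (hP : IsLeftPrimitive P ∨ IsRightPrimitive P) :
    (∃! I : TwoSidedIdeal 𝒩.algebra, 𝒩.IsDiagonalIdeal I ∧ I ≤ P) ∧
    ∀ I : TwoSidedIdeal 𝒩.algebra, 𝒩.IsDiagonalIdeal I → I ≤ P → P ≠ I →
      ∃ p : 𝒩.algebra, IsStarProjection (p : H →L[ℂ] H) ∧ p ≠ 0 ∧ p ∈ P ∧ p ∉ I := by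
  have hP' : IsClosedPrime P := by
    rcases hP with hP | hP
    · exact ⟨hP.mem_or_mem, hP.one_notMem, hP.mem_of_forall_norm_lt⟩
    · exact ⟨hP.mem_or_mem, hP.one_notMem, hP.mem_of_forall_norm_lt⟩
  refine ⟨?_, fun I hI hIP hne => ?_⟩
  · obtain ⟨I, hI, hIP⟩ := Nest.exists_isDiagonalIdeal_le hP'
    exact ⟨I, ⟨hI, hIP⟩, fun J hJ => Nest.eq_of_isDiagonalIdeal_of_le hP' hJ.1 hI hJ.2 hIP⟩
  · obtain ⟨X, hX, hXI⟩ := SetLike.not_le_iff_exists.1 fun h => hne (le_antisymm h hIP)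
    obtain ⟨p, hp, hpP, hpI⟩ := h𝒩.exists_isStarProjection hP' hI hX hXI
    refine ⟨p, hp, ?_, hpP, hpI⟩
    rintro rfl
    exact hpI I.zero_mem
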